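/- **Setting.** Let $K\in\mathbb R^{m\times n}$ with $K^TK$ invertible, $K^\dagger=(K^TK)^{-1}K^T$, and $\beta\ge 0$. For targets $y_1,\dots,y_T\in\mathbb R^m$ and actions $x_1,\dots,x_T\in\mathbb R^n$, $x_0=0$, the cost is $\sum_{t=1}^T\big(\tfrac12\|y_t-Kx_t\|_2^2+\beta\|x_t-x_{t-1}\|_1\big)$. Let $\mathrm{cost}(OPT)$ be its minimum over all $(x_1,\dots,x_T)$ and $\mathrm{cost}(STA)=\min_{x\in\mathbb R^n}\ \sum_{t=1}^T\tfrac12\|y_t-Kx\|_2^2+\beta\|x\|_1$. *Stochastic prediction-error model.* Let $e(1),e(2),\dots$ be i.i.d. random vectors in $\mathbb R^m$ with mean $0$ and positive definite covariance $R_e$, and let $f:\mathbb N\to\mathbb R^{m\times m}$ with $f(0)=I$. Given an instance $\hat y=(\hat y_t)_{t\ge1}$ (arbitrary, deterministic), $y_t=\hat y_t+\sum_{s=1}^t f(t-s)e(s)$, and the prediction of $y_t$ made at time $\tau<t$ is $y_{t|\tau}=\hat y_t+\sum_{s=1}^{\tau}f(t-s)e(s)$. A (possibly randomized) online algorithm starts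 at $x_0=0$ and chooses $x_t$ as a measurable function of internal randomness independent of $e$ and of the information at time $t-1$ (all predictions made up to time $t-1$; given $\hat y$, equivalently $e(1),\dots,e(t-1)$). An algorithm is *constant competitive* if there is $C$ with $\mathbb E[\mathrm{cost}(ALG)]\le C\,\mathbb E[\mathrm{cost}(OPT)]$ for all $T$ and $\hat y$ (all expectations finite), and has *sublinear regret* if $\sup_{\hat y}\mathbb E[\mathrm{cost}(ALG)-\mathrm{cost}(STA)]\le\rho(T)$ for some $\rho(T)=o(T)$ (expectations finite). *AFHC.* For $w\ge0$ and $0\le k\le w$, $\mathrm{FHC}^{(k)}(w+1)$ does the following at each $\tau\in[-w,T]$ with $\tau\equiv k\pmod{w+1}$: with $a=\max(\tau,1)$ and $b=\min(\tau+w,T)$, it chooses $x_a,\dots,x_b$ to minimize $\sum_{t=a}^{b}\tfrac12\|y_{t|a-1}-Kx_t\|_2^2+\beta\|x_t-x_{t-1}\|_1$, where $x_{a-1}$ is its preceding action ($x_0=0$). $\mathrm{AFHC}(w+1)$ plays the average of the actions of the $w+1$ algorithms $\mathrm{FHC}^{(k)}(w+1)$. *Constants.* Let $\|K^\dagger\|=\sup_{\|v\|_2\le1}\|K^\dagger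 v\|_1$, $B=\beta\|K^\dagger\|$, $\|f_w\|^2=\mathrm{tr}\big(R_e\sum_{s=0}^w f(s)^Tf(s)\big)$, $F(w)=\mathrm{tr}\big(R_e\sum_{s=0}^w(w-s+1)f(s)^TKK^\dagger f(s)\big)$, $$V_w=\frac{B\|f_w\|+3B^2}{w+1}+\frac{F(w)}{2(w+1)},$$ and $S(T)=\mathbb E\sum_{t=1}^T\|KK^\dagger(y_t-\bar y)\|_2^2$ with $\bar y=\frac1T\sum_{t=1}^Ty_t$ (this depends on $\hat y$). **Theorem.** (a) Every online algorithm satisfies $\mathbb E[\mathrm{cost}(ALG)]\ge\frac T2\mathrm{tr}(R_e)$ for all $T$ and $\hat y$. (Hence, for $m\ge1$, constant competitiveness is impossible unless $\inf_{\hat y}\mathbb E[\mathrm{cost}(OPT)]=\Omega(T)$, and sublinear regret is impossible unless $\inf_{\hat y}\mathbb E[\mathrm{cost}(STA)]=\Omega(T)$.) Moreover, for every fixed window parameter $w\ge0$ (independent of $T$): (b) for all $T$ and $\hat y$, $\mathrm{cost}(\mathrm{AFHC}(w+1))$ and $\mathrm{cost}(OPT)$ are integrable and $\mathbb E[\mathrm{cost}(\mathrm{AFHC}(w+1))-\mathrm{cost}(OPT)]\le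 V_wT$; (c) if some online algorithm is constant competitive, then $\mathrm{AFHC}(w+1)$ is constant competitive; if $\beta>0$, then $\mathrm{AFHC}(w+1)$ is always constant competitive; (d) if $\inf_{\hat y}S(T)\ge(4V_w+16B^2)\,T-o(T)$, then $\mathrm{AFHC}(w+1)$ has sublinear regret. In particular, if $\beta>0$ (or some online algorithm is constant competitive) and the condition in (d) holds for some fixed $w$, then AFHC with that constant-size window simultaneously has sublinear expected regret and a constant expected competitive ratio. -/

import Mathlib

open MeasureTheory ProbabilityTheory Filter Asymptotics

noncomputable section

namespace OCOPred

variable {m n : ℕ} {Ω : Type*}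

/-! ### The tracking problem with switching costs -/

/-- The squared Euclidean norm of a vector. -/
def sqNorm {d : ℕ} (v : Fin d → ℝ) : ℝ := ∑ i, v i ^ 2

/-- The `ℓ¹` norm of a vector. -/
def l1Norm {d : ℕ} (v : Fin d → ℝ) : ℝ := ∑ i, |v i|

/-- Cost over the times `a, …, b` (with `1 ≤ a`) of the action sequence `x` against the
targets `y`: tracking cost `½‖y_t - K x_t‖₂²` plus switching cost `β‖x_t - x_{t-1}‖₁`. -/
def costOn (K : Matrix (Fin m) (Fin n) ℝ) (β : ℝ) (a b : ℕ)
    (y : ℕ → Fin m → ℝ) (x : ℕ → Fin n → ℝ) : ℝ :=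
  ∑ t ∈ Finset.Icc a b,
    ((1 / 2 : ℝ) * sqNorm (y t - K.mulVec (x t)) + β * l1Norm (x t - x (t - 1)))

/-- Cost over the horizon `1, …, T`. -/
def cost (K : Matrix (Fin m) (Fin n) ℝ) (β : ℝ) (T : ℕ)
    (y : ℕ → Fin m → ℝ) (x : ℕ → Fin n → ℝ) : ℝ :=
  costOn K β 1 T y x

/-- Cost of the offline optimal dynamic solution (all sequences start from `x_0 = 0`). -/
def optCost (K : Matrix (Fin m) (Fin n) ℝ) (β : ℝ) (T : ℕ) (y : ℕ → Fin m → ℝ) : ℝ :=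
  ⨅ x : {x : ℕ → Fin n → ℝ // x 0 = 0}, cost K β T y x.1

/-- Cost of the offline optimal static solution (one switch, from `0` to `x`). -/
def staCost (K : Matrix (Fin m) (Fin n) ℝ) (β : ℝ) (T : ℕ) (y : ℕ → Fin m → ℝ) : ℝ :=
  ⨅ x : Fin n → ℝ,
    (∑ t ∈ Finset.Icc 1 T, (1 / 2 : ℝ) * sqNorm (y t - K.mulVec x)) + β * l1Norm x

/-! ### The stochastic prediction error model -/

/-- `y_{t|τ}`: the prediction of the target `y_t` made at time `τ`, given the time-zero
predictions `yhat` and the realization `e` of the per-step noise. Thus `y_{t|0} = yhat t`, and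
`y_t - y_{t|τ} = ∑_{s=τ+1}^t f(t-s) e(s)` for `τ < t`; for `τ ≥ t` this is `y_t` itself. -/
def pred (f : ℕ → Matrix (Fin m) (Fin m) ℝ) (yhat e : ℕ → Fin m → ℝ) (τ t : ℕ) : Fin m → ℝ :=
  yhat t + ∑ s ∈ Finset.Icc 1 (min τ t), (f (t - s)).mulVec (e s)

/-- The realized target `y_t = yhat_t + ∑_{s=1}^t f(t-s) e(s)`. -/
def target (f : ℕ → Matrix (Fin m) (Fin m) ℝ) (yhat e : ℕ → Fin m → ℝ) (t : ℕ) : Fin m → ℝ :=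
  yhat t + ∑ s ∈ Finset.Icc 1 t, (f (t - s)).mulVec (e s)

/-- The per-step noise terms `e(1), e(2), …` are i.i.d., centered, square integrable, with positive
definite covariance matrix `R`. (The entry `e 0` is never used.) -/
structure IsNoise [MeasurableSpace Ω] (μ : Measure Ω) (R : Matrix (Fin m) (Fin m) ℝ)
    (e : ℕ → Ω → Fin m → ℝ) : Prop where
  indep : iIndepFun (fun s : ℕ => e (s + 1)) μ
  ident : ∀ s ≥ 1, IdentDistrib (e s) (e 1) μ μ
  measurable : ∀ s ≥ 1, Measurable (e s)
  memLp : ∀ s ≥ 1, MemLp (e s) 2 μ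
  mean : ∀ s ≥ 1, ∀ i, ∫ ω, e s ω i ∂μ = 0
  cov : ∀ s ≥ 1, ∀ i j, ∫ ω, e s ω i * e s ω j ∂μ = R i j
  posDef : R.PosDef

/-! ### Averaging Fixed Horizon Control -/

/-- `x` is a run of the `k`-th Fixed Horizon Control algorithm with window `w + 1` on the
horizon `1, …, T`, where `p τ t` is the prediction of `y_t` made at time `τ`. At each
`τ ≡ k mod (w + 1)` in `[-w, T]` the actions at the times `t` of `[τ, τ + w] ∩ [1, T]` are
planned optimally from the preceding action, with the predictions available before the target at
the first planned time is revealed; the actions at nonpositive times are `0`. -/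
def IsFHC (K : Matrix (Fin m) (Fin n) ℝ) (β : ℝ) (T w k : ℕ) (p : ℕ → ℕ → Fin m → ℝ)
    (x : ℕ → Fin n → ℝ) : Prop :=
  x 0 = 0 ∧
  ∀ τ : ℤ, -(w : ℤ) ≤ τ → τ ≤ T → τ ≡ k [ZMOD (w + 1)] →
    ∀ a b : ℕ, (a : ℤ) = max τ 1 → (b : ℤ) = min (τ + w) T →
      ∀ x' : ℕ → Fin n → ℝ, x' (a - 1) = x (a - 1) →
        costOn K β a b (p (a - 1)) x ≤ costOn K β a b (p (a - 1)) x'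

/-- The actions of the `k`-th Fixed Horizon Control algorithm. (For `Kᵀ K` invertible all the
planning problems are strictly convex and coercive in the planned actions, so that a run exists
and is unique at the times `0, …, T`.) -/
def fhc (K : Matrix (Fin m) (Fin n) ℝ) (β : ℝ) (T w k : ℕ) (p : ℕ → ℕ → Fin m → ℝ) :
    ℕ → Fin n → ℝ :=
  Classical.epsilon (IsFHC K β T w k p)

/-- The actions of Averaging Fixed Horizon Control with window `w + 1`. -/
def afhcAction (K : Matrix (Fin m) (Fin n) ℝ) (β : ℝ) (T w : ℕ) (p : ℕ → ℕ → Fin m → ℝ)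
    (t : ℕ) : Fin n → ℝ :=
  (1 / ((w : ℝ) + 1)) • ∑ k ∈ Finset.range (w + 1), fhc K β T w k p t

/-! ### Online algorithms and their performance -/

/-- An algorithm yields, for each horizon `T` and each specification `yhat` of the instance, a
random sequence of actions. -/
abbrev Alg (m n : ℕ) (Ω : Type*) : Type _ := ℕ → (ℕ → Fin m → ℝ) → ℕ → Ω → Fin n → ℝ

/-- AFHC with window `w + 1` in the prediction error model. -/
def afhc (K : Matrix (Fin m) (Fin n) ℝ) (β : ℝ) (f : ℕ → Matrix (Fin m) (Fin m) ℝ)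
    (e : ℕ → Ω → Fin m → ℝ) (w : ℕ) : Alg m n Ω :=
  fun T yhat t ω => afhcAction K β T w (pred f yhat (fun s => e s ω)) t

/-- The random cost of an algorithm. -/
def algCost (K : Matrix (Fin m) (Fin n) ℝ) (β : ℝ) (f : ℕ → Matrix (Fin m) (Fin m) ℝ)
    (e : ℕ → Ω → Fin m → ℝ) (A : Alg m n Ω) (T : ℕ) (yhat : ℕ → Fin m → ℝ) (ω : Ω) : ℝ :=
  cost K β T (target f yhat (fun s => e s ω)) (fun t => A T yhat t ω)

/-- The random cost of the dynamic optimum. -/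
def optCostAt (K : Matrix (Fin m) (Fin n) ℝ) (β : ℝ) (f : ℕ → Matrix (Fin m) (Fin m) ℝ)
    (e : ℕ → Ω → Fin m → ℝ) (T : ℕ) (yhat : ℕ → Fin m → ℝ) (ω : Ω) : ℝ :=
  optCost K β T (target f yhat (fun s => e s ω))

/-- The random cost of the static optimum. -/
def staCostAt (K : Matrix (Fin m) (Fin n) ℝ) (β : ℝ) (f : ℕ → Matrix (Fin m) (Fin m) ℝ)
    (e : ℕ → Ω → Fin m → ℝ) (T : ℕ) (yhat : ℕ → Fin m → ℝ) (ω : Ω) : ℝ :=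
  staCost K β T (target f yhat (fun s => e s ω))

/-- A (possibly randomized) online algorithm: it starts at `0`, and its action at time `t` is a
function of internal randomness `𝒢` independent of the noise, and of the noise at times
`1, …, t - 1`. Given `yhat`, that noise is equivalent to all predictions made at times
`0, …, t - 1`, together with the targets revealed by then. -/
def IsOnline [mΩ : MeasurableSpace Ω] (μ : Measure Ω) (e : ℕ → Ω → Fin m → ℝ)
    (A : Alg m n Ω) : Prop :=
  ∀ (T : ℕ) (yhat : ℕ → Fin m → ℝ),
    (∀ ω, A T yhat 0 ω = 0) ∧
    ∃ 𝒢 : MeasurableSpace Ω, 𝒢 ≤ mΩ ∧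
      Indep 𝒢 (⨆ s ≥ 1, MeasurableSpace.comap (e s) inferInstance) μ ∧
      ∀ t ∈ Finset.Icc 1 T,
        Measurable[𝒢 ⊔ ⨆ s ∈ Finset.Ico 1 t, MeasurableSpace.comap (e s) inferInstance]
          (A T yhat t)

/-- Constant expected competitive ratio:
`sup_{yhat} E[cost(ALG)] / E[cost(OPT)] ≤ C` with `C` independent of `T`. -/
def ConstantCompetitive [MeasurableSpace Ω] (μ : Measure Ω) (K : Matrix (Fin m) (Fin n) ℝ) (β : ℝ)
    (f : ℕ → Matrix (Fin m) (Fin m) ℝ) (e : ℕ → Ω → Fin m → ℝ) (A : Alg m n Ω) : Prop :=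
  ∃ C : ℝ, ∀ (T : ℕ) (yhat : ℕ → Fin m → ℝ),
    Integrable (algCost K β f e A T yhat) μ ∧ Integrable (optCostAt K β f e T yhat) μ ∧
    ∫ ω, algCost K β f e A T yhat ω ∂μ ≤ C * ∫ ω, optCostAt K β f e T yhat ω ∂μ

/-- Sublinear expected regret: `sup_{yhat} E[cost(ALG) - cost(STA)] ≤ ρ(T)` with `ρ(T) = o(T)`. -/
def SublinearRegret [MeasurableSpace Ω] (μ : Measure Ω) (K : Matrix (Fin m) (Fin n) ℝ) (β : ℝ)
    (f : ℕ → Matrix (Fin m) (Fin m) ℝ) (e : ℕ → Ω → Fin m → ℝ) (A : Alg m n Ω) : Prop :=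
  ∃ ρ : ℕ → ℝ, ρ =o[atTop] (fun T : ℕ => (T : ℝ)) ∧
    ∀ (T : ℕ) (yhat : ℕ → Fin m → ℝ),
      Integrable (algCost K β f e A T yhat) μ ∧ Integrable (staCostAt K β f e T yhat) μ ∧
      ∫ ω, (algCost K β f e A T yhat ω - staCostAt K β f e T yhat ω) ∂μ ≤ ρ T

/-! ### The constants of the model -/

/-- The Moore–Penrose pseudoinverse of a matrix with full column rank. -/
def pinv (K : Matrix (Fin m) (Fin n) ℝ) : Matrix (Fin n) (Fin m) ℝ :=
  (K.transpose * K)⁻¹ * K.transpose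

/-- The operator norm of `K†` from `ℓ²` to `ℓ¹`. -/
def pinvNorm (K : Matrix (Fin m) (Fin n) ℝ) : ℝ :=
  sSup {r : ℝ | ∃ v : Fin m → ℝ, sqNorm v ≤ 1 ∧ r = l1Norm ((pinv K).mulVec v)}

/-- `‖f_w‖² = tr(R_e ∑_{s=0}^w f(s)ᵀ f(s))`, square root taken. -/
def fNorm (R : Matrix (Fin m) (Fin m) ℝ) (f : ℕ → Matrix (Fin m) (Fin m) ℝ) (w : ℕ) : ℝ :=
  Real.sqrt (R * ∑ s ∈ Finset.range (w + 1), (f s).transpose * f s).trace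

/-- `F(w) = tr(R_e ∑_{s=0}^w (w - s + 1) f(s)ᵀ K K† f(s))`. -/
def bigF (K : Matrix (Fin m) (Fin n) ℝ) (R : Matrix (Fin m) (Fin m) ℝ)
    (f : ℕ → Matrix (Fin m) (Fin m) ℝ) (w : ℕ) : ℝ :=
  (R * ∑ s ∈ Finset.range (w + 1),
    ((w : ℝ) - (s : ℝ) + 1) • ((f s).transpose * (K * pinv K) * f s)).trace

/-- `B = β ‖K†‖`. -/
def constB (K : Matrix (Fin m) (Fin n) ℝ) (β : ℝ) : ℝ := β * pinvNorm K

/-- `V = (B ‖f_w‖ + 3 B²) / (w + 1) + F(w) / (2 (w + 1))`. -/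
def constV (K : Matrix (Fin m) (Fin n) ℝ) (β : ℝ) (R : Matrix (Fin m) (Fin m) ℝ)
    (f : ℕ → Matrix (Fin m) (Fin m) ℝ) (w : ℕ) : ℝ :=
  (constB K β * fNorm R f w + 3 * constB K β ^ 2) / ((w : ℝ) + 1)
    + bigF K R f w / (2 * ((w : ℝ) + 1))

/-- `∑_{t=1}^T ‖K K† (y_t - ȳ)‖²` with `ȳ = (1/T) ∑_{t=1}^T y_t`. -/
def spread (K : Matrix (Fin m) (Fin n) ℝ) (T : ℕ) (y : ℕ → Fin m → ℝ) : ℝ :=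
  ∑ t ∈ Finset.Icc 1 T,
    sqNorm ((K * pinv K).mulVec (y t - (1 / (T : ℝ)) • ∑ u ∈ Finset.Icc 1 T, y u))

/-- `S(T) = E ∑_{t=1}^T ‖K K† (y_t - ȳ)‖²`. -/
def expSpread [MeasurableSpace Ω] (μ : Measure Ω) (K : Matrix (Fin m) (Fin n) ℝ)
    (f : ℕ → Matrix (Fin m) (Fin m) ℝ) (e : ℕ → Ω → Fin m → ℝ) (T : ℕ)
    (yhat : ℕ → Fin m → ℝ) : ℝ :=
  ∫ ω, spread K T (target f yhat (fun s => e s ω)) ∂μ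

end OCOPred

end

/-!
At the end of one of its windows, a Fixed Horizon Control algorithm is optimal for its own
predictions, and since the other algorithm is optimal for the true targets, exchanging the two plans
shows that its last action is within `O(β ‖K†‖ ‖y - prediction‖ + (β ‖K†‖)²)` of the offline optimal
one, measured by switching costs. In the next window it therefore loses at most this amount and half
the squared prediction errors, as far as the range of `K` sees them. For each time `t` the `w + 1`
algorithms have `w + 1` different window positions at `t`, so averaging turns the prediction errors
into `V_w`, by the orthogonality of the noise.

The lower bound for online algorithms holds since `e t` is independent of everything the action at
time `t` may depend on. For `β > 0` a linear lower bound for the offline optimum follows from weak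
duality: take as dual variable of time `t` a small multiple of the centred sign of a coordinate of
`e t`. For the regret, tracking the targets exactly saves half their spread compared with a static
action, and half of these savings pay for its switching costs.
-/

noncomputable section

namespace OCOPred

open scoped Matrix
open Matrix (mulVec_add mulVec_sub mulVec_smul mulVec_mulVec one_mulVec dotProduct_mulVec
  mulVec_transpose transpose_mul transpose_transpose)

variable {d m n : ℕ} {Ω : Type*}

/-! ### Norms -/

lemma sqNorm_eq_dotProduct (v : Fin d → ℝ) : sqNorm v = v ⬝ᵥ v := by
  simp only [sqNorm, dotProduct, sq]

lemma sqNorm_nonneg (v : Fin d → ℝ) : 0 ≤ sqNorm v :=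
  Finset.sum_nonneg fun _ _ => sq_nonneg _

@[simp] lemma sqNorm_zero : sqNorm (0 : Fin d → ℝ) = 0 := by simp [sqNorm]

@[simp] lemma sqNorm_neg (v : Fin d → ℝ) : sqNorm (-v) = sqNorm v := by simp [sqNorm]

lemma sqNorm_sub_comm (u v : Fin d → ℝ) : sqNorm (u - v) = sqNorm (v - u) := by
  rw [← neg_sub, sqNorm_neg]

lemma sqNorm_smul (c : ℝ) (v : Fin d → ℝ) : sqNorm (c • v) = c ^ 2 * sqNorm v := by
  simp [sqNorm, mul_pow, Finset.mul_sum]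

lemma sqNorm_add (u v : Fin d → ℝ) :
    sqNorm (u + v) = sqNorm u + 2 * (u ⬝ᵥ v) + sqNorm v := by
  simp only [sqNorm_eq_dotProduct, add_dotProduct, dotProduct_add]
  rw [dotProduct_comm v u]
  ring

lemma sqNorm_sub (u v : Fin d → ℝ) :
    sqNorm (u - v) = sqNorm u - 2 * (u ⬝ᵥ v) + sqNorm v := by
  rw [sub_eq_add_neg, sqNorm_add, sqNorm_neg, dotProduct_neg]
  ring

lemma dotProduct_le_half_sqNorm (u v : Fin d → ℝ) :
    u ⬝ᵥ v ≤ 1 / 2 * sqNorm u + 1 / 2 * sqNorm v := by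
  linarith [sqNorm_nonneg (u - v), sqNorm_sub u v]

lemma sqNorm_add_le (u v : Fin d → ℝ) : sqNorm (u + v) ≤ 2 * sqNorm u + 2 * sqNorm v := by
  linarith [dotProduct_le_half_sqNorm u v, sqNorm_add u v]

lemma sqNorm_sub_le (u v : Fin d → ℝ) : sqNorm (u - v) ≤ 2 * sqNorm u + 2 * sqNorm v := by
  simpa only [sub_eq_add_neg, sqNorm_neg] using sqNorm_add_le u (-v)

lemma sqNorm_segment (u v : Fin d → ℝ) (θ : ℝ) :
    sqNorm ((1 - θ) • u + θ • v) =
      (1 - θ) * sqNorm u + θ * sqNorm v - θ * (1 - θ) * sqNorm (u - v) := by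
  rw [sqNorm_add, sqNorm_sub, sqNorm_smul, sqNorm_smul, smul_dotProduct, dotProduct_smul,
    smul_eq_mul, smul_eq_mul]
  ring

lemma eq_zero_of_sqNorm_eq_zero {v : Fin d → ℝ} (h : sqNorm v = 0) : v = 0 :=
  dotProduct_self_eq_zero.1 (sqNorm_eq_dotProduct v ▸ h)

lemma sq_apply_le_sqNorm (v : Fin d → ℝ) (i : Fin d) : v i ^ 2 ≤ sqNorm v :=
  Finset.single_le_sum (f := fun i => v i ^ 2) (fun _ _ => sq_nonneg _) (Finset.mem_univ i)

lemma l1Norm_nonneg (v : Fin d → ℝ) : 0 ≤ l1Norm v :=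
  Finset.sum_nonneg fun _ _ => abs_nonneg _

@[simp] lemma l1Norm_zero : l1Norm (0 : Fin d → ℝ) = 0 := by simp [l1Norm]

@[simp] lemma l1Norm_neg (v : Fin d → ℝ) : l1Norm (-v) = l1Norm v := by simp [l1Norm]

lemma l1Norm_sub_comm (u v : Fin d → ℝ) : l1Norm (u - v) = l1Norm (v - u) := by
  rw [← neg_sub, l1Norm_neg]

lemma l1Norm_smul (c : ℝ) (v : Fin d → ℝ) : l1Norm (c • v) = |c| * l1Norm v := by
  simp [l1Norm, abs_mul, Finset.mul_sum]

lemma l1Norm_add_le (u v : Fin d → ℝ) : l1Norm (u + v) ≤ l1Norm u + l1Norm v := by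
  simp only [l1Norm, ← Finset.sum_add_distrib]
  exact Finset.sum_le_sum fun i _ => abs_add_le _ _

lemma l1Norm_sub_le (u v : Fin d → ℝ) : l1Norm (u - v) ≤ l1Norm u + l1Norm v := by
  simpa only [sub_eq_add_neg, l1Norm_neg] using l1Norm_add_le u (-v)

lemma l1Norm_single (i : Fin d) (s : ℝ) : l1Norm (Pi.single i s) = |s| := by
  simp [l1Norm, Pi.single_apply, apply_ite abs]

lemma norm_le_l1Norm (v : Fin d → ℝ) : ‖v‖ ≤ l1Norm v :=
  (pi_norm_le_iff_of_nonneg (l1Norm_nonneg v)).2 fun i =>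
    Finset.single_le_sum (f := fun i => |v i|) (fun _ _ => abs_nonneg _) (Finset.mem_univ i)

lemma dotProduct_le_mul_l1Norm {g : Fin d → ℝ} {c : ℝ} (hg : ∀ i, |g i| ≤ c) (v : Fin d → ℝ) :
    g ⬝ᵥ v ≤ c * l1Norm v := by
  rw [l1Norm, Finset.mul_sum]
  refine Finset.sum_le_sum fun i _ => (le_abs_self _).trans ?_
  rw [abs_mul]
  exact mul_le_mul_of_nonneg_right (hg i) (abs_nonneg _)

lemma abs_apply_le_of_forall_dotProduct_le {g : Fin d → ℝ} {c : ℝ}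
    (hg : ∀ v, g ⬝ᵥ v ≤ c * l1Norm v) (i : Fin d) : |g i| ≤ c := by
  have hpos := hg (Pi.single i 1)
  have hneg := hg (Pi.single i (-1))
  rw [dotProduct_single, l1Norm_single] at hpos hneg
  norm_num at hpos hneg
  exact abs_le.2 ⟨by linarith, hpos⟩

lemma continuous_sqNorm : Continuous (sqNorm : (Fin d → ℝ) → ℝ) := by
  unfold sqNorm
  fun_prop

lemma continuous_l1Norm : Continuous (l1Norm : (Fin d → ℝ) → ℝ) := by
  unfold l1Norm
  fun_prop

/-! ### The pseudoinverse and the projection onto the range -/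

section PseudoInverse

variable {K : Matrix (Fin m) (Fin n) ℝ}

lemma pinv_mul_self (hK : IsUnit (Kᵀ * K)) : pinv K * K = 1 := by
  rw [pinv, Matrix.mul_assoc]
  exact Matrix.nonsing_inv_mul _ ((Matrix.isUnit_iff_isUnit_det _).1 hK)

lemma pinv_mulVec_mulVec (hK : IsUnit (Kᵀ * K)) (x : Fin n → ℝ) : pinv K *ᵥ K *ᵥ x = x := by
  rw [mulVec_mulVec, pinv_mul_self hK, one_mulVec]

lemma transpose_proj : (K * pinv K)ᵀ = K * pinv K := by
  rw [pinv, transpose_mul, transpose_mul, Matrix.transpose_nonsing_inv, transpose_mul,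
    transpose_transpose, Matrix.mul_assoc]

lemma proj_mul_proj (hK : IsUnit (Kᵀ * K)) : K * pinv K * (K * pinv K) = K * pinv K := by
  rw [Matrix.mul_assoc, ← Matrix.mul_assoc (pinv K), pinv_mul_self hK, Matrix.one_mul]

lemma proj_mulVec_mulVec (hK : IsUnit (Kᵀ * K)) (x : Fin n → ℝ) :
    (K * pinv K) *ᵥ K *ᵥ x = K *ᵥ x := by
  rw [← mulVec_mulVec, pinv_mulVec_mulVec hK]

lemma dotProduct_mulVec_eq_proj (hK : IsUnit (Kᵀ * K)) (v : Fin m → ℝ) (x : Fin n → ℝ) :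
    v ⬝ᵥ K *ᵥ x = (K * pinv K) *ᵥ v ⬝ᵥ K *ᵥ x := by
  conv_lhs => rw [← proj_mulVec_mulVec hK, dotProduct_mulVec, ← mulVec_transpose, transpose_proj]

lemma sqNorm_sub_mulVec (hK : IsUnit (Kᵀ * K)) (v : Fin m → ℝ) (x : Fin n → ℝ) :
    sqNorm (v - K *ᵥ x) =
      sqNorm (v - (K * pinv K) *ᵥ v) + sqNorm ((K * pinv K) *ᵥ v - K *ᵥ x) := by
  have hx := dotProduct_mulVec_eq_proj hK v x
  have hv := dotProduct_mulVec_eq_proj hK v (pinv K *ᵥ v)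
  rw [mulVec_mulVec, ← sqNorm_eq_dotProduct] at hv
  rw [sqNorm_sub, sqNorm_sub, sqNorm_sub, hx, hv]
  ring

lemma eq_pinv_mulVec_sub (hK : IsUnit (Kᵀ * K)) (v : Fin m → ℝ) (x : Fin n → ℝ) :
    x = pinv K *ᵥ v - (Kᵀ * K)⁻¹ *ᵥ Kᵀ *ᵥ (v - K *ᵥ x) := by
  rw [mulVec_mulVec _ (Kᵀ * K)⁻¹, ← pinv, mulVec_sub, pinv_mulVec_mulVec hK, sub_sub_cancel]

lemma pinv_mul_transpose_pinv (hK : IsUnit (Kᵀ * K)) : pinv K * (pinv K)ᵀ = (Kᵀ * K)⁻¹ := by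
  conv_lhs => rw [pinv, transpose_mul, transpose_transpose, Matrix.transpose_nonsing_inv,
    transpose_mul, transpose_transpose, Matrix.mul_assoc, ← Matrix.mul_assoc Kᵀ,
    Matrix.mul_nonsing_inv _ ((Matrix.isUnit_iff_isUnit_det _).1 hK), Matrix.mul_one]

lemma bddAbove_pinvNorm (K : Matrix (Fin m) (Fin n) ℝ) :
    BddAbove {r : ℝ | ∃ v : Fin m → ℝ, sqNorm v ≤ 1 ∧ r = l1Norm (pinv K *ᵥ v)} := by
  refine ⟨∑ i, ∑ j, |pinv K i j|, ?_⟩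
  rintro r ⟨v, hv, rfl⟩
  refine Finset.sum_le_sum fun i _ => ?_
  rw [Matrix.mulVec, dotProduct]
  refine (Finset.abs_sum_le_sum_abs _ _).trans (Finset.sum_le_sum fun j _ => ?_)
  rw [abs_mul]
  exact mul_le_of_le_one_right (abs_nonneg _)
    ((sq_le_one_iff_abs_le_one _).1 ((sq_apply_le_sqNorm v j).trans hv))

lemma pinvNorm_nonneg (K : Matrix (Fin m) (Fin n) ℝ) : 0 ≤ pinvNorm K :=
  le_csSup (bddAbove_pinvNorm K) ⟨0, by simp, by simp⟩

lemma l1Norm_pinv_mulVec_le (K : Matrix (Fin m) (Fin n) ℝ) (v : Fin m → ℝ) :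
    l1Norm (pinv K *ᵥ v) ≤ pinvNorm K * √(sqNorm v) := by
  rcases (sqNorm_nonneg v).eq_or_lt with hv | hv
  · simp [eq_zero_of_sqNorm_eq_zero hv.symm]
  have hs : 0 < √(sqNorm v) := Real.sqrt_pos.2 hv
  have hunit : sqNorm ((√(sqNorm v))⁻¹ • v) ≤ 1 := by
    rw [sqNorm_smul, inv_pow, Real.sq_sqrt hv.le, inv_mul_cancel₀ hv.ne']
  have hle := le_csSup (bddAbove_pinvNorm K) ⟨_, hunit, rfl⟩
  rwa [mulVec_smul, l1Norm_smul, abs_of_pos (inv_pos.2 hs), inv_mul_le_iff₀ hs, mul_comm] at hle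

lemma sqrt_sqNorm_transpose_pinv_mulVec_le (K : Matrix (Fin m) (Fin n) ℝ) {g : Fin n → ℝ} {c : ℝ}
    (hc : 0 ≤ c) (hg : ∀ i, |g i| ≤ c) : √(sqNorm ((pinv K)ᵀ *ᵥ g)) ≤ pinvNorm K * c := by
  set u := (pinv K)ᵀ *ᵥ g
  rcases (Real.sqrt_nonneg (sqNorm u)).eq_or_lt with h | h
  · exact h ▸ mul_nonneg (pinvNorm_nonneg K) hc
  refine le_of_mul_le_mul_right ?_ h
  calc √(sqNorm u) * √(sqNorm u) = g ⬝ᵥ pinv K *ᵥ u := by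
        rw [Real.mul_self_sqrt (sqNorm_nonneg u), sqNorm_eq_dotProduct, dotProduct_mulVec,
          ← mulVec_transpose, transpose_transpose,
          dotProduct_comm]
    _ ≤ c * l1Norm (pinv K *ᵥ u) := dotProduct_le_mul_l1Norm hg _
    _ ≤ c * (pinvNorm K * √(sqNorm u)) :=
        mul_le_mul_of_nonneg_left (l1Norm_pinv_mulVec_le K _) hc
    _ = pinvNorm K * c * √(sqNorm u) := by ring

lemma l1Norm_inv_gram_mulVec_le (hK : IsUnit (Kᵀ * K)) {g : Fin n → ℝ} {c : ℝ}
    (hc : 0 ≤ c) (hg : ∀ i, |g i| ≤ c) : l1Norm ((Kᵀ * K)⁻¹ *ᵥ g) ≤ pinvNorm K ^ 2 * c := by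
  rw [← pinv_mul_transpose_pinv hK, ← mulVec_mulVec, sq, mul_assoc]
  exact (l1Norm_pinv_mulVec_le K _).trans (mul_le_mul_of_nonneg_left
    (sqrt_sqNorm_transpose_pinv_mulVec_le K hc hg) (pinvNorm_nonneg K))

lemma l1Norm_sub_le_pinvNorm_mul_sqrt (hK : IsUnit (Kᵀ * K)) (x x' : Fin n → ℝ) :
    l1Norm (x - x') ≤ pinvNorm K * √(sqNorm (K *ᵥ (x - x'))) := by
  simpa only [pinv_mulVec_mulVec hK] using l1Norm_pinv_mulVec_le K (K *ᵥ (x - x'))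

end PseudoInverse

/-! ### Optimal plans on an interval of times -/

lemma le_of_forall_le_add_mul {r s c : ℝ} (h : ∀ θ : ℝ, 0 < θ → θ ≤ 1 → r ≤ s + θ * c) :
    r ≤ s := by
  have hlim : Tendsto (fun θ : ℝ => s + θ * c) (nhdsWithin 0 (Set.Ioi 0)) (nhds (s + 0 * c)) :=
    (Continuous.tendsto (by fun_prop) 0).mono_left nhdsWithin_le_nhds
  rw [zero_mul, add_zero] at hlim
  refine ge_of_tendsto hlim ?_
  filter_upwards [Ioc_mem_nhdsGT zero_lt_one] with θ hθ using h θ hθ.1 hθ.2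

lemma sum_Icc_add_sum_Icc {M : Type*} [AddCommMonoid M] (g : ℕ → M) {a b c : ℕ}
    (hac : a ≤ c + 1) (hcb : c ≤ b) :
    ∑ t ∈ Finset.Icc a c, g t + ∑ t ∈ Finset.Icc (c + 1) b, g t = ∑ t ∈ Finset.Icc a b, g t := by
  simp only [← Finset.Ico_add_one_right_eq_Icc]
  exact Finset.sum_Ico_consecutive g hac (by omega)

section Plans

variable {K : Matrix (Fin m) (Fin n) ℝ} {β : ℝ} {a b : ℕ} {q q' : ℕ → Fin m → ℝ}
  {x x' : ℕ → Fin n → ℝ}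

/-- The actions of `x` at the times `a, …, b` form an optimal plan for the targets `q`, given the
action of `x` at time `a - 1`. -/
def OptOn (K : Matrix (Fin m) (Fin n) ℝ) (β : ℝ) (a b : ℕ) (q : ℕ → Fin m → ℝ)
    (x : ℕ → Fin n → ℝ) : Prop :=
  ∀ x' : ℕ → Fin n → ℝ, x' (a - 1) = x (a - 1) → costOn K β a b q x ≤ costOn K β a b q x'

lemma costOn_nonneg (hβ : 0 ≤ β) (q : ℕ → Fin m → ℝ) (x : ℕ → Fin n → ℝ) :
    0 ≤ costOn K β a b q x :=
  Finset.sum_nonneg fun _ _ => add_nonneg (mul_nonneg (by norm_num) (sqNorm_nonneg _))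
    (mul_nonneg hβ (l1Norm_nonneg _))

lemma costOn_congr (hq : ∀ t ∈ Finset.Icc a b, q t = q' t)
    (hx : ∀ t, a - 1 ≤ t → t ≤ b → x t = x' t) : costOn K β a b q x = costOn K β a b q' x' := by
  refine Finset.sum_congr rfl fun t ht => ?_
  obtain ⟨hat, htb⟩ := Finset.mem_Icc.1 ht
  rw [hq t ht, hx t (by omega) htb, hx (t - 1) (by omega) (by omega)]

lemma half_sqNorm_sub_mulVec_le_costOn (hβ : 0 ≤ β) (q : ℕ → Fin m → ℝ) (x : ℕ → Fin n → ℝ)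
    {t : ℕ} (ht : t ∈ Finset.Icc a b) :
    1 / 2 * sqNorm (q t - K *ᵥ x t) ≤ costOn K β a b q x := by
  refine (le_add_of_nonneg_right (mul_nonneg hβ (l1Norm_nonneg _))).trans
    (Finset.single_le_sum (f := fun t => (1 / 2 : ℝ) * sqNorm (q t - K *ᵥ x t)
      + β * l1Norm (x t - x (t - 1))) (fun s _ => ?_) ht)
  exact add_nonneg (mul_nonneg (by norm_num) (sqNorm_nonneg _)) (mul_nonneg hβ (l1Norm_nonneg _))

lemma continuous_costOn {X : Type*} [TopologicalSpace X] {q : X → ℕ → Fin m → ℝ}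
    {x : X → ℕ → Fin n → ℝ} (hq : Continuous q) (hx : Continuous x) :
    Continuous fun p => costOn K β a b (q p) (x p) := by
  refine continuous_finsetSum _ fun t _ =>
    ((continuous_sqNorm.comp ?_).const_mul _).add ((continuous_l1Norm.comp ?_).const_mul _)
  · exact ((continuous_apply t).comp hq).sub
      (continuous_const.matrix_mulVec ((continuous_apply t).comp hx))
  · exact ((continuous_apply t).comp hx).sub ((continuous_apply (t - 1)).comp hx)

lemma costOn_segment_le (hβ : 0 ≤ β) (q : ℕ → Fin m → ℝ) (x x' : ℕ → Fin n → ℝ) {θ : ℝ}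
    (h0 : 0 ≤ θ) (h1 : θ ≤ 1) :
    costOn K β a b q ((1 - θ) • x + θ • x') ≤
      (1 - θ) * costOn K β a b q x + θ * costOn K β a b q x'
        - θ * (1 - θ) * (1 / 2 * ∑ t ∈ Finset.Icc a b, sqNorm (K *ᵥ (x t - x' t))) := by
  simp only [costOn, Finset.mul_sum, ← Finset.sum_add_distrib, ← Finset.sum_sub_distrib]
  refine Finset.sum_le_sum fun t _ => ?_
  have htrack : q t - K *ᵥ ((1 - θ) • x + θ • x') t =
      (1 - θ) • (q t - K *ᵥ x t) + θ • (q t - K *ᵥ x' t) := by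
    simp only [Pi.add_apply, Pi.smul_apply, mulVec_add, mulVec_smul]
    module
  have hdiff : q t - K *ᵥ x t - (q t - K *ᵥ x' t) = -K *ᵥ (x t - x' t) := by
    rw [Matrix.neg_mulVec, mulVec_sub]
    abel
  have hstep : ((1 - θ) • x + θ • x') t - ((1 - θ) • x + θ • x') (t - 1) =
      (1 - θ) • (x t - x (t - 1)) + θ • (x' t - x' (t - 1)) := by
    simp only [Pi.add_apply, Pi.smul_apply]
    module
  have hswitch : l1Norm ((1 - θ) • (x t - x (t - 1)) + θ • (x' t - x' (t - 1))) ≤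
      (1 - θ) * l1Norm (x t - x (t - 1)) + θ * l1Norm (x' t - x' (t - 1)) := by
    refine (l1Norm_add_le _ _).trans_eq ?_
    rw [l1Norm_smul, l1Norm_smul, abs_of_nonneg h0, abs_of_nonneg (sub_nonneg.2 h1)]
  rw [htrack, hstep, sqNorm_segment, hdiff, Matrix.neg_mulVec, sqNorm_neg]
  linarith [mul_le_mul_of_nonneg_left hswitch hβ]

lemma convexOn_costOn (hβ : 0 ≤ β) (q : ℕ → Fin m → ℝ) :
    ConvexOn ℝ Set.univ (fun x : ℕ → Fin n → ℝ => costOn K β a b q x) := by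
  refine ⟨convex_univ, fun x _ x' _ s θ hs hθ hsθ => ?_⟩
  obtain rfl : s = 1 - θ := by linarith
  refine (costOn_segment_le hβ q x x' hθ (by linarith)).trans (sub_le_self _ ?_)
  exact mul_nonneg (mul_nonneg hθ hs)
    (mul_nonneg (by norm_num) (Finset.sum_nonneg fun _ _ => sqNorm_nonneg _))

lemma costOn_update_le (ha : 1 ≤ a) (hβ : 0 ≤ β) (q : ℕ → Fin m → ℝ) (x : ℕ → Fin n → ℝ)
    (z : Fin n → ℝ) :
    costOn K β a b q (Function.update x (a - 1) z) ≤
      costOn K β a b q x + β * l1Norm (x (a - 1) - z) := by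
  have hnonneg := mul_nonneg hβ (l1Norm_nonneg (x (a - 1) - z))
  have hfirst : ∑ t ∈ Finset.Icc a b, (if t = a then β * l1Norm (x (a - 1) - z) else 0) ≤
      β * l1Norm (x (a - 1) - z) := by
    rw [Finset.sum_ite_eq']
    split_ifs <;> simp [hnonneg]
  refine le_trans ?_ (add_le_add_right hfirst _)
  rw [costOn, costOn, ← Finset.sum_add_distrib]
  refine Finset.sum_le_sum fun t ht => ?_
  have hat := (Finset.mem_Icc.1 ht).1
  rw [Function.update_of_ne (by omega)]
  split_ifs with hta
  · have htri := mul_le_mul_of_nonneg_left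
      (l1Norm_add_le (x t - x (t - 1)) (x (t - 1) - z)) hβ
    rw [sub_add_sub_cancel] at htri
    rw [← hta, Function.update_self]
    linarith
  · rw [Function.update_of_ne (by omega), add_zero]

lemma OptOn.costOn_add_le (ha : 1 ≤ a) (hβ : 0 ≤ β) (hx : OptOn K β a b q x)
    (x' : ℕ → Fin n → ℝ) :
    costOn K β a b q x + 1 / 2 * ∑ t ∈ Finset.Icc a b, sqNorm (K *ᵥ (x t - x' t)) ≤
      costOn K β a b q x' + β * l1Norm (x' (a - 1) - x (a - 1)) := by
  refine le_trans ?_ (costOn_update_le ha hβ q x' (x (a - 1)))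
  set z := Function.update x' (a - 1) (x (a - 1)) with hz
  have hsum : ∑ t ∈ Finset.Icc a b, sqNorm (K *ᵥ (x t - x' t)) =
      ∑ t ∈ Finset.Icc a b, sqNorm (K *ᵥ (x t - z t)) := by
    refine Finset.sum_congr rfl fun t ht => ?_
    rw [hz, Function.update_of_ne (by have := (Finset.mem_Icc.1 ht).1; omega)]
  rw [hsum]
  set D := 1 / 2 * ∑ t ∈ Finset.Icc a b, sqNorm (K *ᵥ (x t - z t)) with hD
  refine le_of_forall_le_add_mul (c := D) fun θ h0 h1 => le_of_mul_le_mul_left ?_ h0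
  have hopt := hx ((1 - θ) • x + θ • z) (by simp [hz, ← add_smul])
  have hseg := hopt.trans (costOn_segment_le hβ q x z h0.le h1)
  rw [← hD] at hseg
  linarith

lemma costOn_exchange (y q : ℕ → Fin m → ℝ) (x x' : ℕ → Fin n → ℝ) :
    costOn K β a b y x + costOn K β a b q x' = costOn K β a b q x + costOn K β a b y x'
      + ∑ t ∈ Finset.Icc a b, (y t - q t) ⬝ᵥ K *ᵥ (x' t - x t) := by
  simp only [costOn, ← Finset.sum_add_distrib]
  refine Finset.sum_congr rfl fun t _ => ?_
  have hsplit : ∀ z : Fin n → ℝ, y t - K *ᵥ z = (q t - K *ᵥ z) + (y t - q t) := fun z => by abel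
  rw [hsplit (x t), hsplit (x' t), sqNorm_add, sqNorm_add, sub_dotProduct, sub_dotProduct,
    mulVec_sub, dotProduct_sub _ (K *ᵥ x' t), dotProduct_comm (K *ᵥ x t),
    dotProduct_comm (K *ᵥ x' t)]
  ring

lemma OptOn.costOn_le (hK : IsUnit (Kᵀ * K)) (ha : 1 ≤ a) (hβ : 0 ≤ β)
    (hx : OptOn K β a b q x) (y : ℕ → Fin m → ℝ) (x' : ℕ → Fin n → ℝ) :
    costOn K β a b y x ≤ costOn K β a b y x' + β * l1Norm (x' (a - 1) - x (a - 1))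
      + ∑ t ∈ Finset.Icc a b, 1 / 2 * sqNorm ((K * pinv K) *ᵥ (y t - q t)) := by
  have hyoung : ∑ t ∈ Finset.Icc a b, (y t - q t) ⬝ᵥ K *ᵥ (x' t - x t) ≤
      ∑ t ∈ Finset.Icc a b, 1 / 2 * sqNorm ((K * pinv K) *ᵥ (y t - q t))
        + 1 / 2 * ∑ t ∈ Finset.Icc a b, sqNorm (K *ᵥ (x t - x' t)) := by
    rw [Finset.mul_sum, ← Finset.sum_add_distrib]
    refine Finset.sum_le_sum fun t _ => ?_
    rw [dotProduct_mulVec_eq_proj hK, mulVec_sub K (x t), sqNorm_sub_comm (K *ᵥ x t),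
      ← mulVec_sub]
    exact dotProduct_le_half_sqNorm _ _
  linarith [hx.costOn_add_le ha hβ x', costOn_exchange (K := K) (β := β) (a := a) (b := b) y q x x']

lemma OptOn.sum_sqNorm_le (ha : 1 ≤ a) (hβ : 0 ≤ β) (hx : OptOn K β a b q x)
    (hx' : OptOn K β a b q' x') :
    ∑ t ∈ Finset.Icc a b, sqNorm (K *ᵥ (x t - x' t)) ≤
      ∑ t ∈ Finset.Icc a b, sqNorm (q t - q' t) + 4 * (β * l1Norm (x (a - 1) - x' (a - 1))) := by
  have hyoung : ∑ t ∈ Finset.Icc a b, (q t - q' t) ⬝ᵥ K *ᵥ (x t - x' t) ≤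
      1 / 2 * ∑ t ∈ Finset.Icc a b, sqNorm (q t - q' t)
        + 1 / 2 * ∑ t ∈ Finset.Icc a b, sqNorm (K *ᵥ (x t - x' t)) := by
    simp only [Finset.mul_sum, ← Finset.sum_add_distrib]
    exact Finset.sum_le_sum fun t _ => dotProduct_le_half_sqNorm _ _
  have hle := hx.costOn_add_le ha hβ x'
  have hle' := hx'.costOn_add_le ha hβ x
  simp only [mulVec_sub, sqNorm_sub_comm (K *ᵥ x' _)] at hle hle' hyoung ⊢
  rw [l1Norm_sub_comm] at hle
  have hex := costOn_exchange (K := K) (β := β) (a := a) (b := b) q q' x' x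
  simp only [mulVec_sub] at hex
  linarith

lemma OptOn.l1Norm_apply_sub_le (hK : IsUnit (Kᵀ * K)) (ha : 1 ≤ a) (hβ : 0 ≤ β)
    (hx : OptOn K β a b q x) (hx' : OptOn K β a b q' x') {t : ℕ} (ht : t ∈ Finset.Icc a b) :
    l1Norm (x t - x' t) ≤ pinvNorm K * √(∑ t ∈ Finset.Icc a b, sqNorm (q t - q' t)
      + 4 * (β * l1Norm (x (a - 1) - x' (a - 1)))) := by
  refine (l1Norm_sub_le_pinvNorm_mul_sqrt hK _ _).trans
    (mul_le_mul_of_nonneg_left (Real.sqrt_le_sqrt ?_) (pinvNorm_nonneg K))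
  exact (Finset.single_le_sum (f := fun t => sqNorm (K *ᵥ (x t - x' t)))
    (fun _ _ => sqNorm_nonneg _) ht).trans (hx.sum_sqNorm_le ha hβ hx')

lemma continuous_of_optOn {X : Type*} [TopologicalSpace X] (hK : IsUnit (Kᵀ * K)) (ha : 1 ≤ a)
    (hβ : 0 ≤ β) {q : X → ℕ → Fin m → ℝ} {x : X → ℕ → Fin n → ℝ}
    (hx : ∀ p, OptOn K β a b (q p) (x p)) (hq : ∀ t ∈ Finset.Icc a b, Continuous fun p => q p t)
    (hinit : Continuous fun p => x p (a - 1)) {t : ℕ} (ht : t ∈ Finset.Icc a b) :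
    Continuous fun p => x p t := by
  refine continuous_iff_continuousAt.2 fun p₀ => tendsto_iff_norm_sub_tendsto_zero.2 ?_
  refine squeeze_zero (fun _ => norm_nonneg _)
    (fun p => (norm_le_l1Norm _).trans ((hx p).l1Norm_apply_sub_le hK ha hβ (hx p₀) ht)) ?_
  have hcont : Continuous fun p =>
      pinvNorm K * √(∑ t ∈ Finset.Icc a b, sqNorm (q p t - q p₀ t)
        + 4 * (β * l1Norm (x p (a - 1) - x p₀ (a - 1)))) :=
    ((Continuous.add (continuous_finsetSum _ fun s hs =>
      continuous_sqNorm.comp ((hq s hs).sub continuous_const))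
      (((continuous_l1Norm.comp (hinit.sub continuous_const)).const_mul β).const_mul 4)).sqrt
        ).const_mul _
  simpa using hcont.tendsto p₀

lemma costOn_update_add_le (ha : 1 ≤ a) (hβ : 0 ≤ β) (q : ℕ → Fin m → ℝ) (x : ℕ → Fin n → ℝ)
    {t : ℕ} (ht : t ∈ Finset.Icc a b) (h : Fin n → ℝ) :
    costOn K β a b q (Function.update x t (x t + h)) ≤ costOn K β a b q x +
      (1 / 2 * sqNorm (K *ᵥ h) - (q t - K *ᵥ x t) ⬝ᵥ K *ᵥ h
        + β * (if t < b then 2 else 1) * l1Norm h) := by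
  have hat := (Finset.mem_Icc.1 ht).1
  have hsum : ∑ s ∈ Finset.Icc a b, ((if s = t then
      1 / 2 * sqNorm (K *ᵥ h) - (q t - K *ᵥ x t) ⬝ᵥ K *ᵥ h + β * l1Norm h else 0)
        + if s = t + 1 then β * l1Norm h else 0) =
      1 / 2 * sqNorm (K *ᵥ h) - (q t - K *ᵥ x t) ⬝ᵥ K *ᵥ h
        + β * (if t < b then 2 else 1) * l1Norm h := by
    have hmem : t + 1 ∈ Finset.Icc a b ↔ t < b := by
      rw [Finset.mem_Icc]
      omega
    rw [Finset.sum_add_distrib, Finset.sum_ite_eq', Finset.sum_ite_eq', if_pos ht]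
    simp only [hmem]
    split_ifs <;> ring
  rw [← hsum, costOn, costOn, ← Finset.sum_add_distrib]
  refine Finset.sum_le_sum fun s hs => ?_
  have has := (Finset.mem_Icc.1 hs).1
  rcases eq_or_ne s t with rfl | hst
  · rw [Function.update_self, Function.update_of_ne (by omega), if_pos rfl, if_neg (by omega),
      mulVec_add, ← sub_sub, sqNorm_sub, add_sub_right_comm (x s)]
    linarith [mul_le_mul_of_nonneg_left (l1Norm_add_le (x s - x (s - 1)) h) hβ]
  rw [Function.update_of_ne hst, if_neg hst]
  rcases eq_or_ne s (t + 1) with rfl | hst'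
  · rw [if_pos rfl, Nat.add_sub_cancel, Function.update_self, ← sub_sub]
    linarith [mul_le_mul_of_nonneg_left (l1Norm_sub_le (x (t + 1) - x t) h) hβ]
  · rw [Function.update_of_ne (by omega), if_neg hst', add_zero, add_zero]

lemma OptOn.abs_gradient_le (ha : 1 ≤ a) (hβ : 0 ≤ β) (hx : OptOn K β a b q x) {t : ℕ}
    (ht : t ∈ Finset.Icc a b) (i : Fin n) :
    |(Kᵀ *ᵥ (q t - K *ᵥ x t)) i| ≤ β * (if t < b then 2 else 1) := by
  refine abs_apply_le_of_forall_dotProduct_le (fun h => ?_) i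
  rw [mulVec_transpose, ← dotProduct_mulVec]
  refine le_of_forall_le_add_mul (c := 1 / 2 * sqNorm (K *ᵥ h)) fun θ h0 _ =>
    le_of_mul_le_mul_left ?_ h0
  have hopt := hx (Function.update x t (x t + θ • h))
    (by rw [Function.update_of_ne (by have := (Finset.mem_Icc.1 ht).1; omega)])
  have hupd := hopt.trans (costOn_update_add_le ha hβ q x ht (θ • h))
  rw [mulVec_smul, sqNorm_smul, dotProduct_smul, l1Norm_smul, abs_of_pos h0, smul_eq_mul] at hupd
  linarith

/- At its last action the plan `x` is subject to a single switching cost, while `x'` may have two: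
the difference of the gradients is at most `3β`. -/
lemma OptOn.mul_l1Norm_sub_le (hK : IsUnit (Kᵀ * K)) (ha : 1 ≤ a) (hab : a ≤ b) (hβ : 0 ≤ β)
    (hx : OptOn K β a b q x) {a' b' : ℕ} (ha' : 1 ≤ a') (hb : b ∈ Finset.Icc a' b')
    (hx' : OptOn K β a' b' q' x') :
    β * l1Norm (x' b - x b) ≤ constB K β * √(sqNorm (q' b - q b)) + 3 * constB K β ^ 2 := by
  set g := Kᵀ *ᵥ (q b - K *ᵥ x b)
  set g' := Kᵀ *ᵥ (q' b - K *ᵥ x' b)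
  have hdiff : x' b - x b = pinv K *ᵥ (q' b - q b) - (Kᵀ * K)⁻¹ *ᵥ (g' - g) := by
    conv_lhs => rw [eq_pinv_mulVec_sub hK (q' b) (x' b), eq_pinv_mulVec_sub hK (q b) (x b)]
    rw [mulVec_sub (pinv K), mulVec_sub _ g']
    abel
  have hgrad : ∀ i, |(g' - g) i| ≤ 3 * β := by
    intro i
    have hg := hx.abs_gradient_le ha hβ (Finset.right_mem_Icc.2 hab) i
    have hg' := hx'.abs_gradient_le ha' hβ hb i
    rw [if_neg (lt_irrefl b)] at hg
    refine (abs_sub (g' i) (g i)).trans ((add_le_add hg' hg).trans ?_)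
    split_ifs <;> linarith
  rw [hdiff]
  refine (mul_le_mul_of_nonneg_left ((l1Norm_sub_le _ _).trans (add_le_add
    (l1Norm_pinv_mulVec_le K _) (l1Norm_inv_gram_mulVec_le hK (by positivity) hgrad))) hβ).trans_eq
      ?_
  rw [constB]
  ring

lemma l1Norm_le_of_costOn_le (hK : IsUnit (Kᵀ * K)) (hβ : 0 ≤ β) {M : ℝ}
    (hM : costOn K β a b q x ≤ M) {t : ℕ} (ht : t ∈ Finset.Icc a b) :
    l1Norm (x t) ≤ pinvNorm K * √(2 * sqNorm (q t) + 4 * M) := by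
  have hbound := l1Norm_sub_le_pinvNorm_mul_sqrt hK (x t) 0
  rw [sub_zero] at hbound
  refine hbound.trans (mul_le_mul_of_nonneg_left (Real.sqrt_le_sqrt ?_) (pinvNorm_nonneg K))
  have hsq := sqNorm_sub_le (q t) (q t - K *ᵥ x t)
  rw [sub_sub_cancel] at hsq
  linarith [half_sqNorm_sub_mulVec_le_costOn (K := K) hβ q x ht]

lemma isCompact_setOf_costOn_le (hK : IsUnit (Kᵀ * K)) (hβ : 0 ≤ β) (a b : ℕ)
    (q : ℕ → Fin m → ℝ) (z : Fin n → ℝ) (M : ℝ) :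
    IsCompact {x | (∀ t ∉ Finset.Icc a b, x t = z) ∧ costOn K β a b q x ≤ M} := by
  have hbox : IsCompact (Set.univ.pi fun t => if t ∈ Finset.Icc a b then
      Metric.closedBall (0 : Fin n → ℝ) (pinvNorm K * √(2 * sqNorm (q t) + 4 * M)) else {z}) := by
    refine isCompact_univ_pi fun t => ?_
    split_ifs
    exacts [isCompact_closedBall _ _, isCompact_singleton]
  refine hbox.of_isClosed_subset ?_ fun x hx t _ => ?_
  · have hfix : IsClosed {x : ℕ → Fin n → ℝ | ∀ t ∉ Finset.Icc a b, x t = z} := by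
      simp only [Set.ofPred_forall]
      exact isClosed_iInter fun t => isClosed_iInter fun _ =>
        isClosed_eq (continuous_apply t) continuous_const
    exact hfix.inter
      (isClosed_le (continuous_costOn continuous_const continuous_id) continuous_const)
  · by_cases ht : t ∈ Finset.Icc a b
    · simpa only [if_pos ht, mem_closedBall_zero_iff] using
        (norm_le_l1Norm _).trans (l1Norm_le_of_costOn_le hK hβ hx.2 ht)
    · simpa only [if_neg ht] using Set.mem_singleton_iff.2 (hx.1 t ht)

lemma exists_optOn (hK : IsUnit (Kᵀ * K)) (ha : 1 ≤ a) (hβ : 0 ≤ β) (b : ℕ)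
    (q : ℕ → Fin m → ℝ) (z : Fin n → ℝ) : ∃ x, x (a - 1) = z ∧ OptOn K β a b q x := by
  obtain ⟨x, ⟨hxz, hxM⟩, hmin⟩ := (isCompact_setOf_costOn_le hK hβ a b q z
    (costOn K β a b q fun _ => z)).exists_isMinOn ⟨fun _ => z, fun _ _ => rfl, le_rfl⟩
    (continuous_costOn continuous_const continuous_id).continuousOn
  have hinit : x (a - 1) = z := hxz _ (by rw [Finset.mem_Icc]; omega)
  refine ⟨x, hinit, fun x' hx' => ?_⟩
  let x'' : ℕ → Fin n → ℝ := fun t => if t ∈ Finset.Icc a b then x' t else z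
  have heq : costOn K β a b q x' = costOn K β a b q x'' := by
    refine costOn_congr (fun _ _ => rfl) fun t hat htb => ?_
    by_cases ht : t ∈ Finset.Icc a b
    · simp only [x'', if_pos ht]
    · obtain rfl : t = a - 1 := by
        rw [Finset.mem_Icc] at ht
        omega
      simp only [x'', if_neg ht, hx', hinit]
  rw [heq]
  rcases le_total (costOn K β a b q x'') (costOn K β a b q fun _ => z) with hle | hle
  · exact hmin ⟨fun t ht => if_neg ht, hle⟩
  · exact hxM.trans hle

end Plans

/-! ### Fixed Horizon Control -/

/-- The number of times that precede `c` in the window of the `k`-th Fixed Horizon Control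
algorithm containing `c`, for `k ≤ w`; the summand `w + 1` avoids a truncated subtraction. -/
def windowPos (w k c : ℕ) : ℕ := (c + (w + 1) - k) % (w + 1)

/-- The time at which the `k`-th Fixed Horizon Control algorithm plans its action at time `c`, that
is, the last time before the window containing `c`; it is `0` for the first window, which may be
cut off at time `1`. -/
def planTime (w k c : ℕ) : ℕ := c - 1 - windowPos w k c

/-- The time `c` is the last one of a window of the `k`-th Fixed Horizon Control algorithm with
horizon `T`. -/
def IsWindowEnd (T w k c : ℕ) : Prop := c = T ∨ windowPos w k (c + 1) = 0

section Windows

variable {T w k b c : ℕ}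

lemma windowPos_le (w k c : ℕ) : windowPos w k c ≤ w :=
  Nat.lt_succ_iff.1 (Nat.mod_lt _ w.succ_pos)

lemma exists_windowPos_add_mul (w k c : ℕ) :
    ∃ j, windowPos w k c + (w + 1) * j = c + (w + 1) - k :=
  ⟨_, Nat.mod_add_div _ _⟩

lemma windowPos_eq_of_add_mul {r j : ℕ} (hr : r ≤ w) (h : r + (w + 1) * j = c + (w + 1) - k) :
    windowPos w k c = r := by
  rw [windowPos, ← h, Nat.add_mul_mod_self_left, Nat.mod_eq_of_lt (Nat.lt_succ_of_le hr)]

lemma windowPos_sub (hk : k ≤ w) {s : ℕ} (hs : s ≤ windowPos w k c) (hsc : s ≤ c) :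
    windowPos w k (c - s) = windowPos w k c - s := by
  obtain ⟨j, hj⟩ := exists_windowPos_add_mul w k c
  have hle := windowPos_le w k c
  exact windowPos_eq_of_add_mul (j := j) (by omega) (by omega)

lemma windowPos_eq_of_succ (hk : k ≤ w) (h : windowPos w k (c + 1) = 0) : windowPos w k c = w := by
  by_contra hne
  obtain ⟨j, hj⟩ := exists_windowPos_add_mul w k c
  have hle := windowPos_le w k c
  have hsucc := windowPos_eq_of_add_mul (w := w) (k := k) (c := c + 1) (j := j)
    (r := windowPos w k c + 1) (by omega) (by omega)
  omega

lemma windowPos_windowPos (hk : k ≤ w) : windowPos w (windowPos w k c) c = k := by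
  obtain ⟨j, hj⟩ := exists_windowPos_add_mul w k c
  have hle := windowPos_le w k c
  exact windowPos_eq_of_add_mul (j := j) hk (by omega)

lemma sum_windowPos {M : Type*} [AddCommMonoid M] (w c : ℕ) (g : ℕ → M) :
    ∑ k ∈ Finset.range (w + 1), g (windowPos w k c) = ∑ r ∈ Finset.range (w + 1), g r := by
  have hmem : ∀ k ∈ Finset.range (w + 1), windowPos w k c ∈ Finset.range (w + 1) := fun k _ =>
    Finset.mem_range_succ_iff.2 (windowPos_le w k c)
  have hinv : ∀ k ∈ Finset.range (w + 1), windowPos w (windowPos w k c) c = k := fun k hk =>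
    windowPos_windowPos (Finset.mem_range_succ_iff.1 hk)
  exact Finset.sum_bij' (fun k _ => windowPos w k c) (fun r _ => windowPos w r c)
    hmem hmem hinv hinv fun _ _ => rfl

lemma sub_windowPos_modEq (hk : k ≤ w) (c : ℕ) :
    (c : ℤ) - windowPos w k c ≡ k [ZMOD (w + 1)] := by
  obtain ⟨j, hj⟩ := exists_windowPos_add_mul w k c
  zify [show k ≤ c + (w + 1) by omega] at hj
  exact Int.modEq_iff_dvd.2 ⟨1 - j, by linarith⟩

lemma windowPos_eq_of_modEq (hk : k ≤ w) {τ : ℤ} (hτ : τ ≡ k [ZMOD (w + 1)]) (hτc : τ ≤ c)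
    (hcτ : (c : ℤ) ≤ τ + w) : (windowPos w k c : ℤ) = c - τ := by
  have hdvd := ((sub_windowPos_modEq hk c).trans hτ.symm).dvd
  have hle := windowPos_le w k c
  have := Int.eq_zero_of_abs_lt_dvd hdvd (by rw [abs_lt]; omega)
  omega

lemma planTime_lt (hc : 1 ≤ c) : planTime w k c < c := by
  unfold planTime
  omega

lemma planTime_le (w k c : ℕ) : planTime w k c ≤ c := (Nat.sub_le _ _).trans (Nat.sub_le _ _)

lemma sub_planTime_le (c : ℕ) : c - planTime w k c ≤ windowPos w k c + 1 := by
  unfold planTime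
  omega

lemma planTime_eq_of_mem (hk : k ≤ w) (h : b ∈ Finset.Icc (planTime w k c + 1) c) :
    planTime w k b = planTime w k c := by
  obtain ⟨hcb, hbc⟩ := Finset.mem_Icc.1 h
  have hsub := windowPos_sub (c := c) hk (s := c - b) (by unfold planTime at hcb; omega) (by omega)
  rw [Nat.sub_sub_self hbc] at hsub
  unfold planTime at *
  omega

lemma planTime_eq_zero_or (hk : k ≤ w) (c : ℕ) :
    planTime w k c = 0 ∨ windowPos w k (planTime w k c + 1) = 0 := by
  refine or_iff_not_imp_left.2 fun hne => ?_
  unfold planTime at hne ⊢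
  rw [show c - 1 - windowPos w k c + 1 = c - windowPos w k c by omega,
    windowPos_sub hk le_rfl (by omega), Nat.sub_self]

lemma planTime_succ_of_windowPos (h : windowPos w k (c + 1) = 0) : planTime w k (c + 1) = c := by
  unfold planTime
  omega

lemma IsWindowEnd.eq_of_mem (hk : k ≤ w) (hc : IsWindowEnd T w k c) (hbT : b ≤ T)
    (h : c ∈ Finset.Icc (planTime w k b + 1) b) : c = b := by
  have hcb := Finset.mem_Icc.1 h
  by_contra hne
  have hplan := planTime_succ_of_windowPos (hc.resolve_left (by omega))
  rw [planTime_eq_of_mem hk (c := b) (Finset.mem_Icc.2 (by omega))] at hplan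
  omega

lemma window_induction (hk : k ≤ w) {P : ℕ → Prop} (zero : P 0)
    (step : ∀ b ∈ Finset.Icc 1 T, IsWindowEnd T w k b → P (planTime w k b) → P b) : P T := by
  suffices h : ∀ b ≤ T, (b = 0 ∨ IsWindowEnd T w k b) → P b from h T le_rfl (Or.inr (Or.inl rfl))
  intro b
  induction b using Nat.strong_induction_on with
  | _ b ih =>
    intro hbT hb
    rcases Nat.eq_zero_or_pos b with rfl | hpos
    · exact zero
    have hlt := planTime_lt (w := w) (k := k) hpos
    exact step b (Finset.mem_Icc.2 ⟨hpos, hbT⟩) (hb.resolve_left hpos.ne')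
      (ih _ hlt (hlt.le.trans hbT) ((planTime_eq_zero_or hk b).imp_right Or.inr))

end Windows

section FHC

variable {K : Matrix (Fin m) (Fin n) ℝ} {β : ℝ} {T w k b : ℕ} {p : ℕ → ℕ → Fin m → ℝ}
  {x : ℕ → Fin n → ℝ}

lemma isFHC_iff (hk : k ≤ w) : IsFHC K β T w k p x ↔ x 0 = 0 ∧ ∀ c ∈ Finset.Icc 1 T,
    IsWindowEnd T w k c → OptOn K β (planTime w k c + 1) c (p (planTime w k c)) x := by
  refine and_congr_right fun _ => ⟨fun h c hc hend => ?_, fun h τ _ hτT hτ a b ha hb => ?_⟩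
  · have hcT := Finset.mem_Icc.1 hc
    have hle := windowPos_le w k c
    have hfull : c = T ∨ windowPos w k c = w := hend.imp_right (windowPos_eq_of_succ hk)
    have hopt := h (c - windowPos w k c) (by omega) (by omega) (sub_windowPos_modEq hk c)
      (planTime w k c + 1) c (by unfold planTime; omega) (by omega)
    rwa [Nat.add_sub_cancel] at hopt
  · rcases lt_or_ge b a with hba | hab
    · intro x' _
      rw [costOn, costOn, Finset.Icc_eq_empty (by omega), Finset.sum_empty, Finset.sum_empty]
    have hpos := windowPos_eq_of_modEq (c := b) hk hτ (by omega) (by omega)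
    have hplan : planTime w k b = a - 1 := by unfold planTime; omega
    have hend : IsWindowEnd T w k b := by
      refine or_iff_not_imp_left.2 fun hbT => ?_
      have hnext : τ + (w + 1) ≡ k [ZMOD (w + 1)] := (Int.add_emod_right _ _).trans hτ
      have := windowPos_eq_of_modEq (c := b + 1) hk hnext (by push_cast; omega)
        (by push_cast; omega)
      push_cast at this
      omega
    have hopt := h b (Finset.mem_Icc.2 (by omega)) hend
    rwa [hplan, show a - 1 + 1 = a by omega] at hopt

lemma OptOn.congr {a b : ℕ} {q : ℕ → Fin m → ℝ} {x' : ℕ → Fin n → ℝ} (hx : OptOn K β a b q x)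
    (hab : a - 1 ≤ b) (h : ∀ t, a - 1 ≤ t → t ≤ b → x t = x' t) : OptOn K β a b q x' := by
  intro z hz
  rw [← costOn_congr (fun _ _ => rfl) h]
  exact hx z (by rw [hz, h _ le_rfl hab])

lemma exists_isFHC (hK : IsUnit (Kᵀ * K)) (hβ : 0 ≤ β) (hk : k ≤ w) (p : ℕ → ℕ → Fin m → ℝ) :
    ∃ x, IsFHC K β T w k p x := by
  simp_rw [isFHC_iff hk]
  refine window_induction (T := T) hk (P := fun b => ∃ x : ℕ → Fin n → ℝ, x 0 = 0 ∧
    ∀ c ∈ Finset.Icc 1 b, IsWindowEnd T w k c →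
      OptOn K β (planTime w k c + 1) c (p (planTime w k c)) x) ⟨0, rfl, by simp⟩ ?_
  rintro b hb - ⟨x, hx0, hx⟩
  have hbT := Finset.mem_Icc.1 hb
  have hlt := planTime_lt (w := w) (k := k) hbT.1
  obtain ⟨z, hzx, hz⟩ := exists_optOn hK (Nat.succ_pos (planTime w k b)) hβ b
    (p (planTime w k b)) (x (planTime w k b))
  rw [Nat.succ_sub_one] at hzx
  refine ⟨fun t => if t ≤ planTime w k b then x t else z t, by simpa using hx0,
    fun c hc hend => ?_⟩
  have hcb := Finset.mem_Icc.1 hc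
  rcases le_or_gt c (planTime w k b) with hle | hgt
  · refine (hx c (Finset.mem_Icc.2 ⟨hcb.1, hle⟩) hend).congr
      (by rw [Nat.add_sub_cancel]; exact (planTime_lt hcb.1).le) fun t _ htc => ?_
    rw [if_pos (htc.trans hle)]
  · obtain rfl := hend.eq_of_mem hk hbT.2 (Finset.mem_Icc.2 ⟨hgt, hcb.2⟩)
    refine hz.congr (by simpa using hlt.le) fun t ht _ => ?_
    split_ifs with htp
    · obtain rfl : t = planTime w k c := by omega
      exact hzx
    · rfl

lemma fhc_zero (hK : IsUnit (Kᵀ * K)) (hβ : 0 ≤ β) (hk : k ≤ w) (p : ℕ → ℕ → Fin m → ℝ) :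
    fhc K β T w k p 0 = 0 :=
  (Classical.epsilon_spec (exists_isFHC hK hβ hk p)).1

lemma optOn_fhc (hK : IsUnit (Kᵀ * K)) (hβ : 0 ≤ β) (hk : k ≤ w) (p : ℕ → ℕ → Fin m → ℝ)
    (hb : b ∈ Finset.Icc 1 T) (hend : IsWindowEnd T w k b) :
    OptOn K β (planTime w k b + 1) b (p (planTime w k b)) (fhc K β T w k p) :=
  ((isFHC_iff hk).1 (Classical.epsilon_spec (exists_isFHC hK hβ hk p))).2 b hb hend

lemma continuous_fhc {X : Type*} [TopologicalSpace X] (hK : IsUnit (Kᵀ * K)) (hβ : 0 ≤ β)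
    (hk : k ≤ w) {p : X → ℕ → ℕ → Fin m → ℝ} (hp : ∀ τ t, Continuous fun e => p e τ t) {t : ℕ}
    (ht : t ≤ T) : Continuous fun e => fhc K β T w k (p e) t := by
  refine window_induction (T := T) hk
    (P := fun b => ∀ t ≤ b, Continuous fun e => fhc K β T w k (p e) t) ?_ ?_ t ht
  · intro t ht0
    simp only [Nat.le_zero.1 ht0, fhc_zero hK hβ hk]
    exact continuous_const
  · intro b hb hend ih t htb
    rcases le_or_gt t (planTime w k b) with hle | hgt
    · exact ih t hle
    · exact continuous_of_optOn hK (Nat.le_add_left 1 _) hβ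
        (fun e => optOn_fhc hK hβ hk (p e) hb hend) (fun s _ => hp _ s) (ih _ le_rfl)
        (Finset.mem_Icc.2 ⟨hgt, htb⟩)

/-- The bound on how much the `k`-th Fixed Horizon Control algorithm may lose at time `t` against a
dynamic optimum for the targets `y`, when planning with the predictions `p`: half the squared
prediction error seen by `K`, and at the beginning of a window the cost of switching from the last
planned action to the optimal one. -/
def fhcExcess (K : Matrix (Fin m) (Fin n) ℝ) (β : ℝ) (w k : ℕ) (p : ℕ → ℕ → Fin m → ℝ)
    (y : ℕ → Fin m → ℝ) (t : ℕ) : ℝ :=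
  1 / 2 * sqNorm ((K * pinv K) *ᵥ (y t - p (planTime w k t) t)) +
    if windowPos w k t = 0 then
      constB K β * √(sqNorm (y (t - 1) - p (planTime w k (t - 1)) (t - 1))) + 3 * constB K β ^ 2
    else 0

lemma constB_nonneg (hβ : 0 ≤ β) : 0 ≤ constB K β := mul_nonneg hβ (pinvNorm_nonneg K)

lemma mul_l1Norm_sub_fhc_planTime_le (hK : IsUnit (Kᵀ * K)) (hβ : 0 ≤ β) (hk : k ≤ w)
    (p : ℕ → ℕ → Fin m → ℝ) (y : ℕ → Fin m → ℝ) {xs : ℕ → Fin n → ℝ} (hxs0 : xs 0 = 0)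
    (hxs : OptOn K β 1 T y xs) (hb : b ∈ Finset.Icc 1 T) :
    β * l1Norm (xs (planTime w k b) - fhc K β T w k p (planTime w k b)) ≤
      if windowPos w k (planTime w k b + 1) = 0 then
        constB K β * √(sqNorm (y (planTime w k b)
          - p (planTime w k (planTime w k b)) (planTime w k b))) + 3 * constB K β ^ 2
      else 0 := by
  have hbT := Finset.mem_Icc.1 hb
  have hlt := planTime_lt (w := w) (k := k) hbT.1
  set N := planTime w k b
  rcases Nat.eq_zero_or_pos N with h0 | hpos
  · rw [h0, hxs0, fhc_zero hK hβ hk, sub_zero, l1Norm_zero, mul_zero]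
    have hB := constB_nonneg (K := K) hβ
    split_ifs <;> positivity
  · have hNT : N ∈ Finset.Icc 1 T := Finset.mem_Icc.2 ⟨hpos, hlt.le.trans hbT.2⟩
    have hnext : windowPos w k (N + 1) = 0 := (planTime_eq_zero_or hk b).resolve_left hpos.ne'
    rw [if_pos hnext]
    exact (optOn_fhc hK hβ hk p hNT (Or.inr hnext)).mul_l1Norm_sub_le hK (Nat.le_add_left 1 _)
      (planTime_lt hpos) hβ le_rfl hNT hxs

lemma costOn_fhc_le (hK : IsUnit (Kᵀ * K)) (hβ : 0 ≤ β) (hk : k ≤ w)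
    (p : ℕ → ℕ → Fin m → ℝ) (y : ℕ → Fin m → ℝ) {xs : ℕ → Fin n → ℝ} (hxs0 : xs 0 = 0)
    (hxs : OptOn K β 1 T y xs) (hb : b ∈ Finset.Icc 1 T) (hend : IsWindowEnd T w k b) :
    costOn K β (planTime w k b + 1) b y (fhc K β T w k p) ≤
      costOn K β (planTime w k b + 1) b y xs
        + ∑ t ∈ Finset.Icc (planTime w k b + 1) b, fhcExcess K β w k p y t := by
  have hplan := (optOn_fhc hK hβ hk p hb hend).costOn_le hK (Nat.le_add_left 1 _) hβ y xs
  have hswitch := mul_l1Norm_sub_fhc_planTime_le hK hβ hk p y hxs0 hxs hb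
  have hfirst := Finset.single_le_sum (s := Finset.Icc (planTime w k b + 1) b)
    (f := fun t => fhcExcess K β w k p y t
      - 1 / 2 * sqNorm ((K * pinv K) *ᵥ (y t - p (planTime w k t) t)))
    (fun t _ => by
      have hB := constB_nonneg (K := K) hβ
      simp only [fhcExcess, add_sub_cancel_left]
      split_ifs <;> positivity)
    (Finset.left_mem_Icc.2 (planTime_lt (Finset.mem_Icc.1 hb).1))
  have htrack : ∑ t ∈ Finset.Icc (planTime w k b + 1) b,
      1 / 2 * sqNorm ((K * pinv K) *ᵥ (y t - p (planTime w k t) t)) =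
      ∑ t ∈ Finset.Icc (planTime w k b + 1) b,
        1 / 2 * sqNorm ((K * pinv K) *ᵥ (y t - p (planTime w k b) t)) :=
    Finset.sum_congr rfl fun t ht => by rw [planTime_eq_of_mem hk ht]
  rw [Finset.sum_sub_distrib, htrack] at hfirst
  simp only [fhcExcess, add_sub_cancel_left] at hfirst
  rw [Nat.add_sub_cancel] at hplan hfirst
  simp only [fhcExcess]
  linarith

lemma cost_fhc_le (hK : IsUnit (Kᵀ * K)) (hβ : 0 ≤ β) (hk : k ≤ w)
    (p : ℕ → ℕ → Fin m → ℝ) (y : ℕ → Fin m → ℝ) {xs : ℕ → Fin n → ℝ} (hxs0 : xs 0 = 0)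
    (hxs : OptOn K β 1 T y xs) :
    cost K β T y (fhc K β T w k p) ≤
      cost K β T y xs + ∑ t ∈ Finset.Icc 1 T, fhcExcess K β w k p y t := by
  refine window_induction (T := T) hk (P := fun b => costOn K β 1 b y (fhc K β T w k p) ≤
    costOn K β 1 b y xs + ∑ t ∈ Finset.Icc 1 b, fhcExcess K β w k p y t) (by simp [costOn]) ?_
  intro b hb hend ih
  have hle : planTime w k b ≤ b := (planTime_lt (Finset.mem_Icc.1 hb).1).le
  have hwindow := costOn_fhc_le hK hβ hk p y hxs0 hxs hb hend
  have hone : 1 ≤ planTime w k b + 1 := Nat.le_add_left 1 _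
  unfold costOn at hwindow ih ⊢
  rw [← sum_Icc_add_sum_Icc _ hone hle, ← sum_Icc_add_sum_Icc _ hone hle,
    ← sum_Icc_add_sum_Icc _ hone hle]
  linarith

lemma cost_afhcAction_le (hβ : 0 ≤ β) (T w : ℕ) (p : ℕ → ℕ → Fin m → ℝ) (y : ℕ → Fin m → ℝ) :
    cost K β T y (afhcAction K β T w p) ≤
      1 / ((w : ℝ) + 1) * ∑ k ∈ Finset.range (w + 1), cost K β T y (fhc K β T w k p) := by
  have hw : (0 : ℝ) < w + 1 := by positivity
  have hconv := (convexOn_costOn (K := K) (a := 1) (b := T) hβ y).map_sum_le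
    (t := Finset.range (w + 1)) (w := fun _ => 1 / ((w : ℝ) + 1))
    (p := fun k => fhc K β T w k p) (fun _ _ => by positivity)
    (by simp [Finset.sum_const, hw.ne']) (fun _ _ => Set.mem_univ _)
  have haction : afhcAction K β T w p = ∑ k ∈ Finset.range (w + 1),
      (1 / ((w : ℝ) + 1)) • fhc K β T w k p := by
    ext t i
    simp [afhcAction, Finset.mul_sum]
  rw [haction, Finset.mul_sum]
  exact hconv

end FHC

/-! ### The offline optima -/

lemma sum_Icc_pred_add {M : Type*} [AddCommMonoid M] (g : ℕ → M) (T : ℕ) :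
    ∑ t ∈ Finset.Icc 1 T, g (t - 1) + g T = g 0 + ∑ t ∈ Finset.Icc 1 T, g t := by
  induction T with
  | zero => simp
  | succ T ih =>
    rw [Finset.sum_Icc_succ_top (Nat.le_add_left 1 T),
      Finset.sum_Icc_succ_top (Nat.le_add_left 1 T), Nat.add_sub_cancel, ih, add_assoc]

lemma sum_l1Norm_sub_pred_le {x : ℕ → Fin d → ℝ} (hx : x 0 = 0) (z : Fin d → ℝ) (T : ℕ) :
    ∑ t ∈ Finset.Icc 1 T, l1Norm (x t - x (t - 1)) ≤
      l1Norm z + 2 * ∑ t ∈ Finset.Icc 1 T, l1Norm (x t - z) := by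
  have hstep := Finset.sum_le_sum fun t (_ : t ∈ Finset.Icc 1 T) =>
    l1Norm_sub_le (x t - z) (x (t - 1) - z)
  simp only [sub_sub_sub_cancel_right, Finset.sum_add_distrib] at hstep
  have hshift := sum_Icc_pred_add (fun t => l1Norm (x t - z)) T
  have hlast := l1Norm_nonneg (x T - z)
  simp only [hx, zero_sub, l1Norm_neg] at hshift
  linarith

section Offline

variable {K : Matrix (Fin m) (Fin n) ℝ} {β : ℝ} {T : ℕ}

lemma bddBelow_cost (hβ : 0 ≤ β) (y : ℕ → Fin m → ℝ) :
    BddBelow (Set.range fun x : {x : ℕ → Fin n → ℝ // x 0 = 0} => cost K β T y x.1) :=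
  ⟨0, by rintro _ ⟨x, rfl⟩; exact costOn_nonneg hβ _ _⟩

lemma optCost_le_cost (hβ : 0 ≤ β) (y : ℕ → Fin m → ℝ) {x : ℕ → Fin n → ℝ} (hx : x 0 = 0) :
    optCost K β T y ≤ cost K β T y x :=
  ciInf_le (bddBelow_cost hβ y) ⟨x, hx⟩

lemma optCost_nonneg (hβ : 0 ≤ β) (y : ℕ → Fin m → ℝ) : 0 ≤ optCost K β T y :=
  Real.iInf_nonneg fun _ => costOn_nonneg hβ _ _

lemma le_optCost {y : ℕ → Fin m → ℝ} {c : ℝ}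
    (h : ∀ x : ℕ → Fin n → ℝ, x 0 = 0 → c ≤ cost K β T y x) : c ≤ optCost K β T y :=
  have : Nonempty {x : ℕ → Fin n → ℝ // x 0 = 0} := ⟨⟨0, rfl⟩⟩
  le_ciInf fun x => h x.1 x.2

lemma exists_cost_eq_optCost (hK : IsUnit (Kᵀ * K)) (hβ : 0 ≤ β) (y : ℕ → Fin m → ℝ) :
    ∃ x : ℕ → Fin n → ℝ, x 0 = 0 ∧ OptOn K β 1 T y x ∧ cost K β T y x = optCost K β T y := by
  obtain ⟨x, hx0, hx⟩ := exists_optOn hK le_rfl hβ T y 0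
  exact ⟨x, hx0, hx, le_antisymm (le_optCost fun x' hx' => hx x' (hx'.trans hx0.symm))
    (optCost_le_cost hβ y hx0)⟩

lemma staticCost_nonneg (hβ : 0 ≤ β) (y : ℕ → Fin m → ℝ) (x : Fin n → ℝ) :
    0 ≤ (∑ t ∈ Finset.Icc 1 T, (1 / 2 : ℝ) * sqNorm (y t - K *ᵥ x)) + β * l1Norm x :=
  add_nonneg (Finset.sum_nonneg fun _ _ => mul_nonneg (by norm_num) (sqNorm_nonneg _))
    (mul_nonneg hβ (l1Norm_nonneg _))

lemma bddBelow_staticCost (hβ : 0 ≤ β) (y : ℕ → Fin m → ℝ) :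
    BddBelow (Set.range fun x : Fin n → ℝ =>
      (∑ t ∈ Finset.Icc 1 T, (1 / 2 : ℝ) * sqNorm (y t - K *ᵥ x)) + β * l1Norm x) :=
  ⟨0, by rintro _ ⟨x, rfl⟩; exact staticCost_nonneg hβ y x⟩

lemma staCost_nonneg (hβ : 0 ≤ β) (y : ℕ → Fin m → ℝ) : 0 ≤ staCost K β T y :=
  Real.iInf_nonneg fun x => staticCost_nonneg hβ y x

lemma optCost_le_half_sum (hβ : 0 ≤ β) (y : ℕ → Fin m → ℝ) :
    optCost K β T y ≤ ∑ t ∈ Finset.Icc 1 T, (1 / 2 : ℝ) * sqNorm (y t) :=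
  (optCost_le_cost hβ y (x := 0) rfl).trans_eq (by simp [cost, costOn])

lemma staCost_le_half_sum (hβ : 0 ≤ β) (y : ℕ → Fin m → ℝ) :
    staCost K β T y ≤ ∑ t ∈ Finset.Icc 1 T, (1 / 2 : ℝ) * sqNorm (y t) :=
  (ciInf_le (bddBelow_staticCost hβ y) 0).trans_eq (by simp)

lemma measurable_optCost (hβ : 0 ≤ β) : Measurable (optCost K β T) :=
  UpperSemicontinuous.measurable <| upperSemicontinuous_ciInf (fun y => bddBelow_cost hβ y)
    fun _ => (continuous_costOn continuous_id continuous_const).upperSemicontinuous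

lemma measurable_staCost (hβ : 0 ≤ β) : Measurable (staCost K β T) := by
  refine UpperSemicontinuous.measurable (upperSemicontinuous_ciInf
    (fun y => bddBelow_staticCost hβ y) fun x => Continuous.upperSemicontinuous ?_)
  refine (continuous_finsetSum _ fun t _ => (continuous_sqNorm.comp ?_).const_mul _).add
    continuous_const
  exact (continuous_apply t).sub continuous_const

lemma cost_afhcAction_le_optCost_add (hK : IsUnit (Kᵀ * K)) (hβ : 0 ≤ β) (w : ℕ)
    (p : ℕ → ℕ → Fin m → ℝ) (y : ℕ → Fin m → ℝ) :
    cost K β T y (afhcAction K β T w p) ≤ optCost K β T y + 1 / ((w : ℝ) + 1) *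
      ∑ t ∈ Finset.Icc 1 T, ∑ k ∈ Finset.range (w + 1), fhcExcess K β w k p y t := by
  obtain ⟨xs, hxs0, hxs, hopt⟩ := exists_cost_eq_optCost (T := T) hK hβ y
  have hw : (0 : ℝ) < w + 1 := by positivity
  have hfhc := Finset.sum_le_sum fun k (hk : k ∈ Finset.range (w + 1)) =>
    cost_fhc_le hK hβ (Finset.mem_range_succ_iff.1 hk) p y hxs0 hxs
  rw [Finset.sum_add_distrib, Finset.sum_const, Finset.card_range, nsmul_eq_mul, hopt,
    Finset.sum_comm] at hfhc
  refine (cost_afhcAction_le hβ T w p y).trans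
    ((mul_le_mul_of_nonneg_left hfhc (by positivity)).trans_eq ?_)
  rw [mul_add, ← mul_assoc, Nat.cast_add, Nat.cast_one, one_div_mul_cancel hw.ne', one_mul]

lemma spread_le (y : ℕ → Fin m → ℝ) (x : Fin n → ℝ) :
    spread K T y ≤ ∑ t ∈ Finset.Icc 1 T, sqNorm ((K * pinv K) *ᵥ y t - K *ᵥ x) := by
  set c := (1 / (T : ℝ)) • ∑ u ∈ Finset.Icc 1 T, y u with hc
  set P := K * pinv K
  have hcentered : ∑ t ∈ Finset.Icc 1 T, P *ᵥ (y t - c) = 0 := by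
    rw [← Matrix.mulVec_sum, Finset.sum_sub_distrib, Finset.sum_const, Nat.card_Icc,
      Nat.add_sub_cancel]
    rcases Nat.eq_zero_or_pos T with rfl | hT
    · simp
    rw [hc, ← Nat.cast_smul_eq_nsmul ℝ, smul_smul, mul_one_div_cancel (by positivity), one_smul,
      sub_self, Matrix.mulVec_zero]
  have hcross : ∑ t ∈ Finset.Icc 1 T, P *ᵥ (y t - c) ⬝ᵥ (P *ᵥ c - K *ᵥ x) = 0 := by
    rw [← sum_dotProduct, hcentered, zero_dotProduct]
  have hterm : ∀ t ∈ Finset.Icc 1 T, sqNorm (P *ᵥ (y t - c)) ≤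
      sqNorm (P *ᵥ y t - K *ᵥ x) - 2 * (P *ᵥ (y t - c) ⬝ᵥ (P *ᵥ c - K *ᵥ x)) := by
    intro t _
    have hsplit : P *ᵥ y t - K *ᵥ x = P *ᵥ (y t - c) + (P *ᵥ c - K *ᵥ x) := by
      rw [mulVec_sub, sub_add_sub_cancel]
    rw [hsplit, sqNorm_add]
    linarith [sqNorm_nonneg (P *ᵥ c - K *ᵥ x)]
  refine (Finset.sum_le_sum hterm).trans_eq ?_
  rw [Finset.sum_sub_distrib, ← Finset.mul_sum, hcross, mul_zero, sub_zero]

lemma half_sqNorm_sub_proj_add_l1Norm_le (hK : IsUnit (Kᵀ * K)) (hβ : 0 ≤ β) (v : Fin m → ℝ)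
    (x : Fin n → ℝ) :
    1 / 2 * sqNorm (v - (K * pinv K) *ᵥ v) + 2 * (β * l1Norm (pinv K *ᵥ v - x)) ≤
      1 / 2 * sqNorm (v - K *ᵥ x)
        + (4 * constB K β ^ 2 - 1 / 4 * sqNorm ((K * pinv K) *ᵥ v - K *ᵥ x)) := by
  set u := √(sqNorm ((K * pinv K) *ᵥ v - K *ᵥ x)) with hu
  have hsq : u ^ 2 = sqNorm ((K * pinv K) *ᵥ v - K *ᵥ x) := Real.sq_sqrt (sqNorm_nonneg _)
  have hswitch : β * l1Norm (pinv K *ᵥ v - x) ≤ constB K β * u := by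
    rw [constB, mul_assoc, hu, ← mulVec_mulVec, ← mulVec_sub]
    exact mul_le_mul_of_nonneg_left (l1Norm_sub_le_pinvNorm_mul_sqrt hK _ _) hβ
  rw [sqNorm_sub_mulVec hK v x, ← hsq]
  linarith [sq_nonneg (u - 4 * constB K β)]

/-
Compare with the plan that tracks the targets exactly, `x_t = K† y_t`: relative to a fixed `x` it
saves half the spread, and Young's inequality pays its switching costs with half of these savings.
-/
lemma optCost_le_staCost_add (hK : IsUnit (Kᵀ * K)) (hβ : 0 ≤ β) (y : ℕ → Fin m → ℝ) :
    optCost K β T y ≤ staCost K β T y + (4 * constB K β ^ 2 * T - 1 / 4 * spread K T y) := by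
  rw [← sub_le_iff_le_add]
  refine le_ciInf fun x => ?_
  set X : ℕ → Fin n → ℝ := Function.update (fun t => pinv K *ᵥ y t) 0 0
  have hXt : ∀ t ∈ Finset.Icc 1 T, X t = pinv K *ᵥ y t := fun t ht =>
    Function.update_of_ne (Nat.one_le_iff_ne_zero.1 (Finset.mem_Icc.1 ht).1) _ _
  have hX0 : X 0 = 0 := Function.update_self _ _ _
  have hswitch := mul_le_mul_of_nonneg_left (sum_l1Norm_sub_pred_le hX0 x T) hβ
  have hyoung := Finset.sum_le_sum fun t (_ : t ∈ Finset.Icc 1 T) =>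
    half_sqNorm_sub_proj_add_l1Norm_le hK hβ (y t) x
  have htrack : ∀ t ∈ Finset.Icc 1 T, y t - K *ᵥ X t = y t - (K * pinv K) *ᵥ y t := fun t ht => by
    rw [hXt t ht, mulVec_mulVec]
  have hcost := optCost_le_cost (K := K) (T := T) hβ y hX0
  rw [cost, costOn, Finset.sum_add_distrib,
    Finset.sum_congr rfl fun t ht => congrArg (fun v => 1 / 2 * sqNorm v) (htrack t ht)] at hcost
  rw [Finset.sum_congr rfl fun t ht => congrArg (fun v => l1Norm (v - x)) (hXt t ht)] at hswitch
  simp only [Finset.sum_add_distrib, Finset.sum_sub_distrib, ← Finset.mul_sum,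
    Finset.sum_const, Nat.card_Icc, Nat.add_sub_cancel, nsmul_eq_mul] at hyoung hcost ⊢
  linarith [spread_le (K := K) (T := T) y x]

/- Weak duality: `g` is a feasible point of the problem dual to the minimization of `cost`. -/
lemma sum_dotProduct_sub_le_cost {y g : ℕ → Fin m → ℝ} (hy : y 0 = 0)
    (hg : ∀ t i, |(Kᵀ *ᵥ g t) i| ≤ β) {x : ℕ → Fin n → ℝ} (hx : x 0 = 0) :
    ∑ t ∈ Finset.Icc 1 T, (g t ⬝ᵥ (y t - y (t - 1)) - 2 * sqNorm (g t)) ≤ cost K β T y x := by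
  set r : ℕ → Fin m → ℝ := fun t => y t - K *ᵥ x t with hr
  have hyoung : ∀ u z : Fin m → ℝ, u ⬝ᵥ z ≤ sqNorm u + 1 / 4 * sqNorm z := fun u z => by
    have := dotProduct_le_half_sqNorm ((2 : ℝ) • u) z
    rw [sqNorm_smul, smul_dotProduct, smul_eq_mul] at this
    linarith
  have hstep : ∀ t ∈ Finset.Icc 1 T, g t ⬝ᵥ (y t - y (t - 1)) - 2 * sqNorm (g t) ≤
      β * l1Norm (x t - x (t - 1)) + 1 / 4 * sqNorm (r t) + 1 / 4 * sqNorm (r (t - 1)) := by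
    intro t _
    have hsplit : y t - y (t - 1) = K *ᵥ (x t - x (t - 1)) + r t + -r (t - 1) := by
      simp only [hr, mulVec_sub]
      abel
    have hswitch := dotProduct_le_mul_l1Norm (hg t) (x t - x (t - 1))
    rw [mulVec_transpose, ← dotProduct_mulVec] at hswitch
    have hlast := hyoung (g t) (-r (t - 1))
    rw [sqNorm_neg] at hlast
    rw [hsplit, dotProduct_add, dotProduct_add]
    linarith [hyoung (g t) (r t)]
  have hsum := Finset.sum_le_sum hstep
  have hshift := sum_Icc_pred_add (fun t => sqNorm (r t)) T
  have hlast := sqNorm_nonneg (r T)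
  have hfirst : sqNorm (r 0) = 0 := by simp [hr, hy, hx]
  rw [cost, costOn]
  simp only [Finset.sum_add_distrib, ← Finset.mul_sum] at hsum ⊢
  linarith

end Offline

/-! ### Independence and second moments -/

section Probability

variable [mΩ : MeasurableSpace Ω] {μ : Measure Ω}

lemma indep_sup_left [IsProbabilityMeasure μ] {m₁ m₂ m₃ : MeasurableSpace Ω} (h₁ : m₁ ≤ mΩ)
    (h₂ : m₂ ≤ mΩ) (h₃ : m₃ ≤ mΩ) (h : Indep m₁ (m₂ ⊔ m₃) μ) (h' : Indep m₂ m₃ μ) :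
    Indep (m₁ ⊔ m₂) m₃ μ := by
  have hl₂ : m₂ ≤ m₂ ⊔ m₃ := le_sup_left
  have hl₃ : m₃ ≤ m₂ ⊔ m₃ := le_sup_right
  have hgen : m₁ ⊔ m₂ = MeasurableSpace.generateFrom
      (Set.image2 (· ∩ ·) {a | MeasurableSet[m₁] a} {b | MeasurableSet[m₂] b}) := by
    refine le_antisymm (sup_le (fun a ha => ?_) fun b hb => ?_)
      (MeasurableSpace.generateFrom_le ?_)
    · exact .basic a ⟨a, ha, Set.univ, @MeasurableSet.univ _ m₂, Set.inter_univ a⟩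
    · exact .basic b ⟨Set.univ, @MeasurableSet.univ _ m₁, b, hb, Set.univ_inter b⟩
    · rintro _ ⟨a, ha, b, hb, rfl⟩
      exact MeasurableSet.inter (le_sup_left (a := m₁) a ha) (le_sup_right (b := m₂) b hb)
  refine IndepSets.indep (sup_le h₁ h₂) h₃ ?_ (@MeasurableSpace.isPiSystem_measurableSet Ω m₃)
    hgen (@MeasurableSpace.generateFrom_measurableSet Ω m₃).symm ?_
  · rintro _ ⟨a, ha, b, hb, rfl⟩ _ ⟨a', ha', b', hb', rfl⟩ _
    exact ⟨a ∩ a', MeasurableSet.inter ha ha', b ∩ b', MeasurableSet.inter hb hb',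
      Set.inter_inter_inter_comm _ _ _ _⟩
  · rw [IndepSets_iff]
    rintro _ c ⟨a, ha, b, hb, rfl⟩ hc
    rw [Indep_iff] at h h'
    rw [Set.inter_assoc, h a (b ∩ c) ha (MeasurableSet.inter (hl₂ b hb) (hl₃ c hc)),
      h a b ha (hl₂ b hb), h' b c hb hc, mul_assoc]

lemma integrable_sqrt [IsFiniteMeasure μ] {X : Ω → ℝ} (hX : Integrable X μ) :
    Integrable (fun ω => √(X ω)) μ := by
  refine (hX.norm.add (integrable_const 1)).mono'
    (Real.continuous_sqrt.comp_aestronglyMeasurable hX.1) (ae_of_all _ fun ω => ?_)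
  rw [Real.norm_of_nonneg (Real.sqrt_nonneg _)]
  refine Real.sqrt_le_iff.2 ⟨add_nonneg (norm_nonneg _) zero_le_one, ?_⟩
  dsimp only [Pi.add_apply]
  nlinarith [le_abs_self (X ω), Real.norm_eq_abs (X ω), norm_nonneg (X ω)]

lemma integral_sqrt_le_sqrt_integral [IsProbabilityMeasure μ] {X : Ω → ℝ} (hX : Integrable X μ)
    (h0 : 0 ≤ᵐ[μ] X) : ∫ ω, √(X ω) ∂μ ≤ √(∫ ω, X ω ∂μ) :=
  Real.strictConcaveOn_sqrt.concaveOn.le_map_integral Real.continuous_sqrt.continuousOn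
    isClosed_Ici h0 hX (integrable_sqrt hX)

lemma measurable_mulVec (A : Matrix (Fin m) (Fin n) ℝ) :
    Measurable fun x : Fin n → ℝ => A *ᵥ x :=
  (Continuous.matrix_mulVec continuous_const continuous_id).measurable

lemma memLp_mulVec {v : Ω → Fin n → ℝ} {r : ENNReal} (hv : MemLp v r μ)
    (A : Matrix (Fin m) (Fin n) ℝ) : MemLp (fun ω => A *ᵥ v ω) r μ :=
  (LinearMap.toContinuousLinearMap A.mulVecLin).comp_memLp' hv

lemma integrable_dotProduct {u v : Ω → Fin d → ℝ} (hu : MemLp u 2 μ) (hv : MemLp v 2 μ) :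
    Integrable (fun ω => u ω ⬝ᵥ v ω) μ :=
  integrable_finsetSum _ fun i _ => (hu.eval i).integrable_mul (hv.eval i)

lemma memLp_two_iff_integrable_sqNorm {v : Ω → Fin d → ℝ} (hv : AEStronglyMeasurable v μ) :
    MemLp v 2 μ ↔ Integrable (fun ω => sqNorm (v ω)) μ := by
  refine ⟨fun h => ?_, fun h => MemLp.of_eval fun i => ?_⟩
  · simpa only [sqNorm_eq_dotProduct] using integrable_dotProduct h h
  · have hvi : AEStronglyMeasurable (fun ω => v ω i) μ :=
      (continuous_apply i).comp_aestronglyMeasurable hv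
    refine (memLp_two_iff_integrable_sq hvi).2 (h.mono' (hvi.pow 2) (ae_of_all _ fun ω => ?_))
    rw [Real.norm_of_nonneg (sq_nonneg _)]
    exact sq_apply_le_sqNorm _ i

lemma integrable_sqNorm {v : Ω → Fin d → ℝ} (hv : MemLp v 2 μ) :
    Integrable (fun ω => sqNorm (v ω)) μ :=
  (memLp_two_iff_integrable_sqNorm hv.1).1 hv

lemma integral_dotProduct_eq_zero_of_indepFun {u v : Ω → Fin d → ℝ} (hu : Integrable u μ)
    (hv : Integrable v μ) (huv : IndepFun u v μ) (hv0 : ∀ i, ∫ ω, v ω i ∂μ = 0) :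
    ∫ ω, u ω ⬝ᵥ v ω ∂μ = 0 := by
  have hind : ∀ i, IndepFun (fun ω => u ω i) (fun ω => v ω i) μ := fun i =>
    huv.comp (measurable_pi_apply i) (measurable_pi_apply i)
  have hint : ∀ i, Integrable (fun ω => u ω i * v ω i) μ := fun i =>
    (hind i).integrable_mul (hu.eval i) (hv.eval i)
  simp only [dotProduct]
  rw [integral_finsetSum _ fun i _ => hint i]
  refine Finset.sum_eq_zero fun i _ => ?_
  rw [(hind i).integral_fun_mul_eq_mul_integral (hu.eval i).1 (hv.eval i).1, hv0, mul_zero]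

lemma integral_sqNorm_sum {ι : Type*} {S : Finset ι} {X : ι → Ω → Fin d → ℝ}
    (hX : ∀ s ∈ S, MemLp (X s) 2 μ)
    (horth : ∀ s ∈ S, ∀ t ∈ S, s ≠ t → ∫ ω, X s ω ⬝ᵥ X t ω ∂μ = 0) :
    ∫ ω, sqNorm (∑ s ∈ S, X s ω) ∂μ = ∑ s ∈ S, ∫ ω, sqNorm (X s ω) ∂μ := by
  have hint : ∀ s ∈ S, ∀ t ∈ S, Integrable (fun ω => X s ω ⬝ᵥ X t ω) μ := fun s hs t ht =>
    integrable_dotProduct (hX s hs) (hX t ht)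
  simp only [sqNorm_eq_dotProduct, sum_dotProduct, dotProduct_sum]
  rw [integral_finsetSum _ fun t ht => integrable_finsetSum _ fun s hs => hint s hs t ht]
  refine Finset.sum_congr rfl fun t ht => ?_
  rw [integral_finsetSum _ fun s hs => hint s hs t ht,
    Finset.sum_eq_single_of_mem t ht fun s hs hst => horth s hs t ht hst]

lemma integral_sqNorm_add {u v : Ω → Fin d → ℝ} (hu : MemLp u 2 μ) (hv : MemLp v 2 μ)
    (horth : ∫ ω, u ω ⬝ᵥ v ω ∂μ = 0) :
    ∫ ω, sqNorm (u ω + v ω) ∂μ = ∫ ω, sqNorm (u ω) ∂μ + ∫ ω, sqNorm (v ω) ∂μ := by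
  have hcross : Integrable (fun ω => 2 * (u ω ⬝ᵥ v ω)) μ :=
    (integrable_dotProduct hu hv).const_mul 2
  have hleft : Integrable (fun ω => sqNorm (u ω) + 2 * (u ω ⬝ᵥ v ω)) μ :=
    (integrable_sqNorm hu).add hcross
  simp only [sqNorm_add]
  rw [integral_add hleft (integrable_sqNorm hv),
    integral_add (integrable_sqNorm hu) hcross, integral_const_mul, horth, mul_zero, add_zero]

lemma ofReal_integral_sqNorm_le_lintegral_add [IsFiniteMeasure μ] {u v : Ω → Fin d → ℝ}
    (hu : MemLp u 2 μ) (hv : AEStronglyMeasurable v μ) (huv : IndepFun u v μ)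
    (hu0 : ∀ i, ∫ ω, u ω i ∂μ = 0) :
    ENNReal.ofReal (∫ ω, sqNorm (u ω) ∂μ) ≤ ∫⁻ ω, ENNReal.ofReal (sqNorm (u ω + v ω)) ∂μ := by
  by_cases htop : ∫⁻ ω, ENNReal.ofReal (sqNorm (u ω + v ω)) ∂μ = ⊤
  · exact htop ▸ le_top
  have hsum : AEStronglyMeasurable (fun ω => u ω + v ω) μ := hu.1.add hv
  have hint : Integrable (fun ω => sqNorm (u ω + v ω)) μ :=
    (lintegral_ofReal_ne_top_iff_integrable (continuous_sqNorm.comp_aestronglyMeasurable hsum)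
      (ae_of_all _ fun _ => sqNorm_nonneg _)).1 htop
  have hv2 : MemLp v 2 μ :=
    (((memLp_two_iff_integrable_sqNorm hsum).2 hint).sub hu).ae_eq
      (ae_of_all _ fun ω => add_sub_cancel_left (u ω) (v ω))
  have horth : ∫ ω, u ω ⬝ᵥ v ω ∂μ = 0 := by
    simpa only [dotProduct_comm] using integral_dotProduct_eq_zero_of_indepFun
      (hv2.integrable one_le_two) (hu.integrable one_le_two) huv.symm hu0
  rw [← ofReal_integral_eq_lintegral_ofReal hint (ae_of_all _ fun _ => sqNorm_nonneg _),
    integral_sqNorm_add hu hv2 horth]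
  exact ENNReal.ofReal_le_ofReal
    (le_add_of_nonneg_right (integral_nonneg fun _ => sqNorm_nonneg _))

end Probability

/-! ### The noise and the prediction errors -/

section Noise

variable [mΩ : MeasurableSpace Ω] {μ : Measure Ω} {R : Matrix (Fin m) (Fin m) ℝ}
  {e : ℕ → Ω → Fin m → ℝ} {s t : ℕ}

lemma IsNoise.indepFun (he : IsNoise μ R e) (hs : 1 ≤ s) (ht : 1 ≤ t) (hst : s ≠ t) :
    IndepFun (e s) (e t) μ := by
  obtain ⟨s, rfl⟩ := Nat.exists_eq_add_of_le' hs
  obtain ⟨t, rfl⟩ := Nat.exists_eq_add_of_le' ht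
  exact he.indep.indepFun (by omega)

lemma IsNoise.integral_dotProduct_mulVec_self (he : IsNoise μ R e) (hs : 1 ≤ s)
    (M : Matrix (Fin m) (Fin m) ℝ) : ∫ ω, e s ω ⬝ᵥ M *ᵥ e s ω ∂μ = (R * M).trace := by
  have hL2 := he.memLp s hs
  have hint : ∀ i j, Integrable (fun ω => M i j * (e s ω j * e s ω i)) μ := fun i j =>
    ((hL2.eval j).integrable_mul (hL2.eval i)).const_mul _
  have hexpand : ∀ ω, e s ω ⬝ᵥ M *ᵥ e s ω = ∑ i, ∑ j, M i j * (e s ω j * e s ω i) := fun ω => by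
    simp only [dotProduct, Matrix.mulVec, Finset.mul_sum]
    exact Finset.sum_congr rfl fun i _ => Finset.sum_congr rfl fun j _ => by ring
  simp_rw [hexpand]
  rw [integral_finsetSum _ fun i _ => integrable_finsetSum _ fun j _ => hint i j]
  simp_rw [fun i => integral_finsetSum Finset.univ fun j _ => hint i j, integral_const_mul,
    he.cov s hs]
  rw [Matrix.trace, Finset.sum_comm]
  simp only [Matrix.diag_apply, Matrix.mul_apply]
  exact Finset.sum_congr rfl fun i _ => Finset.sum_congr rfl fun j _ => mul_comm _ _

lemma IsNoise.integral_sqNorm_mulVec (he : IsNoise μ R e) (hs : 1 ≤ s)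
    (A : Matrix (Fin d) (Fin m) ℝ) : ∫ ω, sqNorm (A *ᵥ e s ω) ∂μ = (R * (Aᵀ * A)).trace := by
  rw [← he.integral_dotProduct_mulVec_self hs]
  simp only [sqNorm_eq_dotProduct, ← mulVec_mulVec, dotProduct_mulVec _ Aᵀ, Matrix.vecMul_transpose]

lemma IsNoise.trace_nonneg (he : IsNoise μ R e) (A : Matrix (Fin d) (Fin m) ℝ) :
    0 ≤ (R * (Aᵀ * A)).trace := by
  rw [← he.integral_sqNorm_mulVec le_rfl]
  exact integral_nonneg fun _ => sqNorm_nonneg _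

lemma IsNoise.integral_mulVec_apply [IsFiniteMeasure μ] (he : IsNoise μ R e) (hs : 1 ≤ s)
    (A : Matrix (Fin d) (Fin m) ℝ) (i : Fin d) : ∫ ω, (A *ᵥ e s ω) i ∂μ = 0 := by
  have hint : ∀ j, Integrable (fun ω => A i j * e s ω j) μ := fun j =>
    (((he.memLp s hs).eval j).integrable one_le_two).const_mul _
  simp only [Matrix.mulVec, dotProduct]
  rw [integral_finsetSum _ fun j _ => hint j]
  exact Finset.sum_eq_zero fun j _ => by rw [integral_const_mul, he.mean s hs, mul_zero]

lemma IsNoise.integral_dotProduct_mulVec_eq_zero [IsFiniteMeasure μ] (he : IsNoise μ R e)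
    (hs : 1 ≤ s) (ht : 1 ≤ t) (hst : s ≠ t) {φ : (Fin m → ℝ) → Fin d → ℝ} (hφ : Measurable φ)
    (hint : Integrable (fun ω => φ (e s ω)) μ) (A : Matrix (Fin d) (Fin m) ℝ) :
    ∫ ω, φ (e s ω) ⬝ᵥ A *ᵥ e t ω ∂μ = 0 :=
  integral_dotProduct_eq_zero_of_indepFun hint
    ((memLp_mulVec (he.memLp t ht) A).integrable one_le_two)
    ((he.indepFun hs ht hst).comp hφ (measurable_mulVec A)) (he.integral_mulVec_apply ht A)

lemma IsNoise.memLp_sum (he : IsNoise μ R e) {S : Finset ℕ} (hS : ∀ s ∈ S, 1 ≤ s)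
    (A : ℕ → Matrix (Fin d) (Fin m) ℝ) : MemLp (fun ω => ∑ s ∈ S, A s *ᵥ e s ω) 2 μ :=
  memLp_finsetSum S fun s hs => memLp_mulVec (he.memLp s (hS s hs)) (A s)

lemma IsNoise.integral_sqNorm_sum [IsFiniteMeasure μ] (he : IsNoise μ R e) {S : Finset ℕ}
    (hS : ∀ s ∈ S, 1 ≤ s) (A : ℕ → Matrix (Fin d) (Fin m) ℝ) :
    ∫ ω, sqNorm (∑ s ∈ S, A s *ᵥ e s ω) ∂μ = ∑ s ∈ S, (R * ((A s)ᵀ * A s)).trace := by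
  have hL2 : ∀ s ∈ S, MemLp (fun ω => A s *ᵥ e s ω) 2 μ := fun s hs =>
    memLp_mulVec (he.memLp s (hS s hs)) (A s)
  have horth : ∀ s ∈ S, ∀ t ∈ S, s ≠ t → ∫ ω, A s *ᵥ e s ω ⬝ᵥ A t *ᵥ e t ω ∂μ = 0 :=
    fun s hs t ht hst => he.integral_dotProduct_mulVec_eq_zero (hS s hs) (hS t ht) hst
      (measurable_mulVec (A s)) ((hL2 s hs).integrable one_le_two) (A t)
  rw [OCOPred.integral_sqNorm_sum hL2 horth]
  exact Finset.sum_congr rfl fun s hs => he.integral_sqNorm_mulVec (hS s hs) (A s)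

end Noise

section Prediction

variable {f : ℕ → Matrix (Fin m) (Fin m) ℝ} {yhat : ℕ → Fin m → ℝ} {τ t : ℕ}

lemma target_sub_pred (e : ℕ → Fin m → ℝ) (hτt : τ ≤ t) :
    target f yhat e t - pred f yhat e τ t = ∑ s ∈ Finset.Ioc τ t, f (t - s) *ᵥ e s := by
  have hunion : Finset.Icc 1 t = Finset.Icc 1 τ ∪ Finset.Ioc τ t := by
    ext s; simp only [Finset.mem_union, Finset.mem_Icc, Finset.mem_Ioc]; omega
  have hdisj : Disjoint (Finset.Icc 1 τ) (Finset.Ioc τ t) := by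
    rw [Finset.disjoint_left]; intro s; simp only [Finset.mem_Icc, Finset.mem_Ioc]; omega
  rw [target, pred, min_eq_left hτt, hunion, Finset.sum_union hdisj]
  abel

lemma target_eq_add_sum_Ico (hf : f 0 = 1) (e : ℕ → Fin m → ℝ) (ht : 1 ≤ t) :
    target f yhat e t = yhat t + e t + ∑ s ∈ Finset.Ico 1 t, f (t - s) *ᵥ e s := by
  rw [target, ← Finset.Ico_insert_right ht, Finset.sum_insert Finset.right_notMem_Ico,
    Nat.sub_self, hf, one_mulVec, add_assoc]

lemma pred_congr {e e' : ℕ → Fin m → ℝ} (h : ∀ s, 1 ≤ s → e s = e' s) :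
    pred f yhat e = pred f yhat e' := by
  ext1 τ; ext1 t
  exact congrArg _ (Finset.sum_congr rfl fun s hs => by rw [h s (Finset.mem_Icc.1 hs).1])

lemma continuous_pred (τ t : ℕ) : Continuous fun e => pred f yhat e τ t :=
  continuous_const.add (continuous_finsetSum _ fun s _ =>
    Continuous.matrix_mulVec continuous_const (continuous_apply s))

lemma sum_Ioc_sub {M : Type*} [AddCommMonoid M] (g : ℕ → M) (τ t : ℕ) :
    ∑ s ∈ Finset.Ioc τ t, g (t - s) = ∑ j ∈ Finset.range (t - τ), g j := by
  refine Finset.sum_bij' (fun s _ => t - s) (fun j _ => t - j) ?_ ?_ ?_ ?_ fun _ _ => rfl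
  all_goals
    intro a ha
    simp only [Finset.mem_Ioc, Finset.mem_range] at *
    omega

variable [mΩ : MeasurableSpace Ω] {μ : Measure Ω} {R : Matrix (Fin m) (Fin m) ℝ}
  {e : ℕ → Ω → Fin m → ℝ}

lemma IsNoise.memLp_target [IsFiniteMeasure μ] (he : IsNoise μ R e)
    (f : ℕ → Matrix (Fin m) (Fin m) ℝ) (yhat : ℕ → Fin m → ℝ) (t : ℕ) :
    MemLp (fun ω => target f yhat (fun s => e s ω) t) 2 μ :=
  (memLp_const (yhat t)).add (he.memLp_sum (S := Finset.Icc 1 t)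
    (fun _ hs => (Finset.mem_Icc.1 hs).1) fun s => f (t - s))

lemma IsNoise.measurable_target (he : IsNoise μ R e) (f : ℕ → Matrix (Fin m) (Fin m) ℝ)
    (yhat : ℕ → Fin m → ℝ) : Measurable (fun ω => target f yhat (fun s => e s ω)) :=
  measurable_pi_lambda _ fun _ => measurable_const.add <| Finset.measurable_sum _ fun s hs =>
    (measurable_mulVec _).comp (he.measurable s (Finset.mem_Icc.1 hs).1)

lemma IsNoise.memLp_target_sub_pred (he : IsNoise μ R e) (hτt : τ ≤ t) :
    MemLp (fun ω => target f yhat (fun s => e s ω) t - pred f yhat (fun s => e s ω) τ t) 2 μ := by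
  simp only [target_sub_pred _ hτt]
  exact he.memLp_sum (fun s hs => Nat.one_le_of_lt (Finset.mem_Ioc.1 hs).1) fun s => f (t - s)

lemma IsNoise.integral_sqNorm_mulVec_target_sub_pred [IsFiniteMeasure μ] (he : IsNoise μ R e)
    (hτt : τ ≤ t) (A : Matrix (Fin d) (Fin m) ℝ) :
    ∫ ω, sqNorm (A *ᵥ (target f yhat (fun s => e s ω) t - pred f yhat (fun s => e s ω) τ t)) ∂μ =
      ∑ j ∈ Finset.range (t - τ), (R * ((A * f j)ᵀ * (A * f j))).trace := by
  simp only [target_sub_pred _ hτt, Matrix.mulVec_sum, mulVec_mulVec]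
  rw [← sum_Ioc_sub]
  exact he.integral_sqNorm_sum (fun s hs => Nat.one_le_of_lt (Finset.mem_Ioc.1 hs).1)
    fun s => A * f (t - s)

lemma IsNoise.integral_sqrt_sqNorm_target_sub_pred_le [IsProbabilityMeasure μ]
    (he : IsNoise μ R e) {w : ℕ} (hτt : τ ≤ t) (hw : t - τ ≤ w + 1) :
    ∫ ω, √(sqNorm (target f yhat (fun s => e s ω) t - pred f yhat (fun s => e s ω) τ t)) ∂μ ≤
      fNorm R f w := by
  have hvar := he.integral_sqNorm_mulVec_target_sub_pred (f := f) (yhat := yhat) hτt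
    (1 : Matrix (Fin m) (Fin m) ℝ)
  simp only [one_mulVec, Matrix.one_mul] at hvar
  refine (integral_sqrt_le_sqrt_integral (integrable_sqNorm (he.memLp_target_sub_pred hτt))
    (ae_of_all _ fun _ => sqNorm_nonneg _)).trans (Real.sqrt_le_sqrt ?_)
  rw [hvar, Matrix.mul_sum, Matrix.trace_sum]
  exact Finset.sum_le_sum_of_subset_of_nonneg (Finset.range_subset_range.2 hw)
    fun j _ _ => he.trace_nonneg _

lemma sum_range_sum_range (c : ℕ → ℝ) (w : ℕ) :
    ∑ d ∈ Finset.range (w + 1), ∑ j ∈ Finset.range (d + 1), c j =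
      ∑ s ∈ Finset.range (w + 1), ((w : ℝ) - s + 1) * c s := by
  induction w with
  | zero => simp
  | succ w ih =>
    rw [Finset.sum_range_succ, ih, Finset.sum_range_succ _ (w + 1), Finset.sum_range_succ _ (w + 1),
      ← add_assoc, ← Finset.sum_add_distrib]
    congr 1
    · refine Finset.sum_congr rfl fun s _ => ?_
      push_cast; ring
    · push_cast; ring

lemma bigF_eq_sum_sum {K : Matrix (Fin m) (Fin n) ℝ} (hK : IsUnit (Kᵀ * K)) (w : ℕ) :
    bigF K R f w = ∑ d ∈ Finset.range (w + 1), ∑ j ∈ Finset.range (d + 1),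
      (R * ((K * pinv K * f j)ᵀ * (K * pinv K * f j))).trace := by
  rw [sum_range_sum_range, bigF, Matrix.mul_sum, Matrix.trace_sum]
  refine Finset.sum_congr rfl fun s _ => ?_
  have hproj : (K * pinv K * f s)ᵀ * (K * pinv K * f s) = (f s)ᵀ * (K * pinv K) * f s := by
    rw [transpose_mul, transpose_proj, Matrix.mul_assoc, ← Matrix.mul_assoc (K * pinv K),
      proj_mul_proj hK, ← Matrix.mul_assoc]
  rw [Matrix.mul_smul, Matrix.trace_smul, smul_eq_mul, hproj]

end Prediction

/-! ### Online algorithms pay for the noise -/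

section LowerBound

variable {f : ℕ → Matrix (Fin m) (Fin m) ℝ} {e : ℕ → Ω → Fin m → ℝ} {t : ℕ}

lemma algCost_nonneg {K : Matrix (Fin m) (Fin n) ℝ} {β : ℝ} (hβ : 0 ≤ β) (A : Alg m n Ω) (T : ℕ)
    (yhat : ℕ → Fin m → ℝ) (ω : Ω) : 0 ≤ algCost K β f e A T yhat ω :=
  costOn_nonneg hβ _ _

lemma sum_half_sqNorm_le_algCost {K : Matrix (Fin m) (Fin n) ℝ} {β : ℝ} (hβ : 0 ≤ β)
    (A : Alg m n Ω) (T : ℕ) (yhat : ℕ → Fin m → ℝ) (ω : Ω) :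
    ∑ t ∈ Finset.Icc 1 T,
      1 / 2 * sqNorm (target f yhat (fun s => e s ω) t - K *ᵥ A T yhat t ω) ≤
        algCost K β f e A T yhat ω :=
  Finset.sum_le_sum fun _ _ => le_add_of_nonneg_right (mul_nonneg hβ (l1Norm_nonneg _))

/-- The information at time `t - 1`: the internal randomness `𝒢` of an algorithm and the noise at
the times `1, …, t - 1`. -/
abbrev past (𝒢 : MeasurableSpace Ω) (e : ℕ → Ω → Fin m → ℝ) (t : ℕ) : MeasurableSpace Ω :=
  𝒢 ⊔ ⨆ s ∈ Finset.Ico 1 t, MeasurableSpace.comap (e s) inferInstance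

lemma measurable_past {𝒢 : MeasurableSpace Ω} {s : ℕ} (hs : s ∈ Finset.Ico 1 t) :
    Measurable[past 𝒢 e t] (e s) :=
  (comap_measurable (e s)).mono (le_sup_of_le_right (le_iSup₂_of_le s hs le_rfl)) le_rfl

variable {𝒢 : MeasurableSpace Ω} [mΩ : MeasurableSpace Ω] {μ : Measure Ω}
  {R : Matrix (Fin m) (Fin m) ℝ}

lemma IsNoise.past_le (he : IsNoise μ R e) (h𝒢 : 𝒢 ≤ mΩ) (t : ℕ) : past 𝒢 e t ≤ mΩ :=
  sup_le h𝒢 (iSup₂_le fun s hs => (he.measurable s (Finset.mem_Ico.1 hs).1).comap_le)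

lemma IsNoise.indep_past [IsProbabilityMeasure μ] (he : IsNoise μ R e) (h𝒢 : 𝒢 ≤ mΩ)
    (hind : Indep 𝒢 (⨆ s ≥ 1, MeasurableSpace.comap (e s) inferInstance) μ) (ht : 1 ≤ t) :
    Indep (past 𝒢 e t) (MeasurableSpace.comap (e t) inferInstance) μ := by
  have hcomap : ∀ s, 1 ≤ s → MeasurableSpace.comap (e s) inferInstance ≤ mΩ := fun s hs =>
    (he.measurable s hs).comap_le
  have hnoise : Indep (⨆ s ∈ Finset.Ico 1 t, MeasurableSpace.comap (e s) inferInstance)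
      (MeasurableSpace.comap (e t) inferInstance) μ := by
    have hdisj : Disjoint {s | s + 1 < t} {t - 1} :=
      Set.disjoint_singleton_right.2 fun h => by rw [Set.mem_ofPred_eq] at h; omega
    refine indep_of_indep_of_le_left (indep_of_indep_of_le_right (indep_iSup_of_disjoint
      (fun s => hcomap (s + 1) (Nat.le_add_left 1 s)) he.indep hdisj) ?_) ?_
    · exact le_iSup₂_of_le (t - 1) rfl (by rw [Nat.sub_add_cancel ht])
    · refine iSup₂_le fun s hs => ?_
      obtain ⟨hs1, hst⟩ := Finset.mem_Ico.1 hs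
      refine le_iSup₂_of_le (s - 1) (by rw [Set.mem_ofPred_eq]; omega) ?_
      rw [Nat.sub_add_cancel hs1]
  refine indep_sup_left h𝒢 (iSup₂_le fun s hs => hcomap s (Finset.mem_Ico.1 hs).1)
    (hcomap t ht) (indep_of_indep_of_le_right hind (sup_le ?_ ?_)) hnoise
  · exact iSup₂_le fun s hs => le_iSup₂_of_le s (Finset.mem_Ico.1 hs).1 le_rfl
  · exact le_iSup₂_of_le t ht le_rfl

lemma IsNoise.ofReal_trace_le_lintegral_sqNorm_target_sub [IsProbabilityMeasure μ]
    (he : IsNoise μ R e) (hf : f 0 = 1) (h𝒢 : 𝒢 ≤ mΩ)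
    (hind : Indep 𝒢 (⨆ s ≥ 1, MeasurableSpace.comap (e s) inferInstance) μ)
    (yhat : ℕ → Fin m → ℝ) (ht : 1 ≤ t) {z : Ω → Fin m → ℝ} (hz : Measurable[past 𝒢 e t] z) :
    ENNReal.ofReal R.trace ≤
      ∫⁻ ω, ENNReal.ofReal (sqNorm (target f yhat (fun s => e s ω) t - z ω)) ∂μ := by
  set v : Ω → Fin m → ℝ := fun ω =>
    yhat t + ∑ s ∈ Finset.Ico 1 t, f (t - s) *ᵥ e s ω - z ω with hv
  have hvm : Measurable[past 𝒢 e t] v :=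
    Measurable.sub (measurable_const.add (Finset.measurable_sum _ fun s hs =>
      (measurable_mulVec _).comp (measurable_past hs))) hz
  have hindep : IndepFun (e t) v μ :=
    (IndepFun_iff_Indep _ _ _).2
      (indep_of_indep_of_le_right (he.indep_past h𝒢 hind ht).symm hvm.comap_le)
  have hsplit : ∀ ω, target f yhat (fun s => e s ω) t - z ω = e t ω + v ω := fun ω => by
    simp only [hv]
    rw [target_eq_add_sum_Ico hf _ ht]
    abel
  have hvar : ∫ ω, sqNorm (e t ω) ∂μ = R.trace := by
    simpa using he.integral_sqNorm_mulVec ht (1 : Matrix (Fin m) (Fin m) ℝ)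
  simp only [hsplit]
  exact hvar ▸ ofReal_integral_sqNorm_le_lintegral_add (he.memLp t ht)
    (hvm.mono (he.past_le h𝒢 t) le_rfl).aestronglyMeasurable hindep (he.mean t ht)

lemma IsNoise.lintegral_algCost_ge [IsProbabilityMeasure μ] (he : IsNoise μ R e) (hf : f 0 = 1)
    {K : Matrix (Fin m) (Fin n) ℝ} {β : ℝ} (hβ : 0 ≤ β) {A : Alg m n Ω} (hA : IsOnline μ e A)
    (T : ℕ) (yhat : ℕ → Fin m → ℝ) :
    ENNReal.ofReal ((T : ℝ) / 2 * R.trace) ≤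
      ∫⁻ ω, ENNReal.ofReal (algCost K β f e A T yhat ω) ∂μ := by
  obtain ⟨-, 𝒢, h𝒢, hind, hmeas⟩ := hA T yhat
  set r : ℕ → Ω → ℝ := fun t ω =>
    sqNorm (target f yhat (fun s => e s ω) t - K *ᵥ A T yhat t ω)
  have hKA : ∀ t ∈ Finset.Icc 1 T, Measurable[past 𝒢 e t] fun ω => K *ᵥ A T yhat t ω :=
    fun t ht => (measurable_mulVec K).comp (hmeas t ht)
  have hrm : ∀ t ∈ Finset.Icc 1 T, Measurable[mΩ] fun ω => ENNReal.ofReal (1 / 2 * r t ω) := by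
    intro t ht
    refine ((continuous_sqNorm.measurable.comp (Measurable.sub ?_ ?_)).const_mul _).ennreal_ofReal
    · exact (measurable_pi_apply t).comp (IsNoise.measurable_target (mΩ := mΩ) he f yhat)
    · exact (hKA t ht).mono (IsNoise.past_le (mΩ := mΩ) he h𝒢 t) le_rfl
  have hterm : ∀ t ∈ Finset.Icc 1 T, ENNReal.ofReal (1 / 2 * R.trace) ≤
      ∫⁻ ω, ENNReal.ofReal (1 / 2 * r t ω) ∂μ := by
    intro t ht
    have hhalf : (0 : ℝ) ≤ 1 / 2 := by norm_num
    simp only [ENNReal.ofReal_mul hhalf]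
    rw [lintegral_const_mul' _ _ ENNReal.ofReal_ne_top]
    gcongr
    exact IsNoise.ofReal_trace_le_lintegral_sqNorm_target_sub (mΩ := mΩ) he hf h𝒢 hind yhat
      (Finset.mem_Icc.1 ht).1 (hKA t ht)
  calc ENNReal.ofReal ((T : ℝ) / 2 * R.trace)
      = ∑ t ∈ Finset.Icc 1 T, ENNReal.ofReal (1 / 2 * R.trace) := by
        rw [Finset.sum_const, Nat.card_Icc, Nat.add_sub_cancel, ← ENNReal.ofReal_nsmul,
          nsmul_eq_mul, ← mul_assoc, mul_one_div]
    _ ≤ ∑ t ∈ Finset.Icc 1 T, ∫⁻ ω, ENNReal.ofReal (1 / 2 * r t ω) ∂μ := Finset.sum_le_sum hterm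
    _ = ∫⁻ ω, ∑ t ∈ Finset.Icc 1 T, ENNReal.ofReal (1 / 2 * r t ω) ∂μ :=
        (lintegral_finsetSum' _ fun t ht => (hrm t ht).aemeasurable).symm
    _ ≤ ∫⁻ ω, ENNReal.ofReal (algCost K β f e A T yhat ω) ∂μ := by
        refine lintegral_mono fun ω => ?_
        rw [← ENNReal.ofReal_sum_of_nonneg fun t _ =>
          mul_nonneg (by norm_num) (sqNorm_nonneg _)]
        exact ENNReal.ofReal_le_ofReal (sum_half_sqNorm_le_algCost hβ A T yhat ω)

end LowerBound

/-! ### The expected competitive difference and regret of Averaging Fixed Horizon Control -/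

section Difference

variable [MeasurableSpace Ω] {μ : Measure Ω} {K : Matrix (Fin m) (Fin n) ℝ} {β : ℝ}
  {f : ℕ → Matrix (Fin m) (Fin m) ℝ} {R : Matrix (Fin m) (Fin m) ℝ} {e : ℕ → Ω → Fin m → ℝ}

lemma IsNoise.integrable_sum_half_sqNorm_target [IsFiniteMeasure μ] (he : IsNoise μ R e) (T : ℕ)
    (yhat : ℕ → Fin m → ℝ) : Integrable (fun ω => ∑ t ∈ Finset.Icc 1 T,
      (1 / 2 : ℝ) * sqNorm (target f yhat (fun s => e s ω) t)) μ :=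
  integrable_finsetSum _ fun t _ => (integrable_sqNorm (he.memLp_target f yhat t)).const_mul _

lemma IsNoise.integrable_optCostAt [IsFiniteMeasure μ] (he : IsNoise μ R e) (hβ : 0 ≤ β) (T : ℕ)
    (yhat : ℕ → Fin m → ℝ) : Integrable (optCostAt K β f e T yhat) μ := by
  refine (he.integrable_sum_half_sqNorm_target (f := f) T yhat).mono'
    ((measurable_optCost hβ).comp (he.measurable_target f yhat)).aestronglyMeasurable
    (ae_of_all _ fun ω => ?_)
  rw [optCostAt, Real.norm_of_nonneg (optCost_nonneg hβ _)]
  exact optCost_le_half_sum hβ _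

lemma IsNoise.integrable_staCostAt [IsFiniteMeasure μ] (he : IsNoise μ R e) (hβ : 0 ≤ β) (T : ℕ)
    (yhat : ℕ → Fin m → ℝ) : Integrable (staCostAt K β f e T yhat) μ := by
  refine (he.integrable_sum_half_sqNorm_target (f := f) T yhat).mono'
    ((measurable_staCost hβ).comp (he.measurable_target f yhat)).aestronglyMeasurable
    (ae_of_all _ fun ω => ?_)
  rw [staCostAt, Real.norm_of_nonneg (staCost_nonneg hβ _)]
  exact staCost_le_half_sum hβ _

lemma IsNoise.integrable_spread [IsFiniteMeasure μ] (he : IsNoise μ R e) (T : ℕ)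
    (yhat : ℕ → Fin m → ℝ) :
    Integrable (fun ω => spread K T (target f yhat (fun s => e s ω))) μ :=
  integrable_finsetSum _ fun t _ => integrable_sqNorm <| memLp_mulVec
    ((he.memLp_target f yhat t).sub
      ((memLp_finsetSum _ fun u _ => he.memLp_target f yhat u).const_smul (1 / (T : ℝ)))) _

lemma IsNoise.measurable_afhc (he : IsNoise μ R e) (hK : IsUnit (Kᵀ * K)) (hβ : 0 ≤ β)
    (w : ℕ) {T t : ℕ} (ht : t ≤ T) (yhat : ℕ → Fin m → ℝ) :
    Measurable (afhc K β f e w T yhat t) := by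
  have hcont : Continuous fun v : ℕ → Fin m → ℝ => afhcAction K β T w (pred f yhat v) t :=
    (continuous_finsetSum _ fun k hk => continuous_fhc hK hβ (Finset.mem_range_succ_iff.1 hk)
      continuous_pred ht).const_smul (1 / ((w : ℝ) + 1))
  -- `e 0` need not be measurable, but it does not enter the predictions.
  have hmeas : Measurable fun ω => Function.update (fun s => e s ω) 0 0 := by
    refine measurable_pi_lambda _ fun s => ?_
    rcases Nat.eq_zero_or_pos s with rfl | hs
    · simp only [Function.update_self, measurable_const]
    · simpa only [Function.update_of_ne hs.ne'] using he.measurable s hs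
  have heq : afhc K β f e w T yhat t = fun ω => afhcAction K β T w
      (pred f yhat (Function.update (fun s => e s ω) 0 0)) t := by
    ext1 ω
    rw [afhc, pred_congr fun s hs =>
      (Function.update_of_ne (Nat.one_le_iff_ne_zero.1 hs) 0 fun s => e s ω).symm]
  exact heq ▸ hcont.measurable.comp hmeas

lemma IsNoise.measurable_algCost (he : IsNoise μ R e) {A : Alg m n Ω} {T : ℕ}
    {yhat : ℕ → Fin m → ℝ} (hA : ∀ t ≤ T, Measurable (A T yhat t)) :
    Measurable (algCost K β f e A T yhat) := by
  unfold algCost cost costOn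
  refine Finset.measurable_sum _ fun t ht => ?_
  have htT := (Finset.mem_Icc.1 ht).2
  refine ((continuous_sqNorm.measurable.comp (Measurable.sub ?_ ?_)).const_mul _).add
    ((continuous_l1Norm.measurable.comp ?_).const_mul _)
  · exact (measurable_pi_apply t).comp (he.measurable_target f yhat)
  · exact (measurable_mulVec K).comp (hA t htT)
  · exact (hA t htT).sub (hA (t - 1) (by omega))

lemma IsNoise.integrable_fhcExcess [IsFiniteMeasure μ] (he : IsNoise μ R e) (w k t : ℕ)
    (yhat : ℕ → Fin m → ℝ) :
    Integrable (fun ω => fhcExcess K β w k (pred f yhat fun s => e s ω)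
      (target f yhat fun s => e s ω) t) μ := by
  refine ((integrable_sqNorm (memLp_mulVec
    (he.memLp_target_sub_pred (planTime_le w k t)) _)).const_mul _).add ?_
  split_ifs
  · exact ((integrable_sqrt (integrable_sqNorm
      (he.memLp_target_sub_pred (planTime_le w k (t - 1))))).const_mul _).add (integrable_const _)
  · exact integrable_zero _ _ _

lemma IsNoise.integral_fhcExcess_le [IsProbabilityMeasure μ] (he : IsNoise μ R e) (hβ : 0 ≤ β)
    (w k t : ℕ) (yhat : ℕ → Fin m → ℝ) :
    ∫ ω, fhcExcess K β w k (pred f yhat fun s => e s ω) (target f yhat fun s => e s ω) t ∂μ ≤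
      1 / 2 * ∑ j ∈ Finset.range (windowPos w k t + 1),
        (R * ((K * pinv K * f j)ᵀ * (K * pinv K * f j))).trace +
      if windowPos w k t = 0 then constB K β * fNorm R f w + 3 * constB K β ^ 2 else 0 := by
  have hplan := planTime_le w k (t - 1)
  have htrack := integrable_sqNorm (memLp_mulVec
    (he.memLp_target_sub_pred (f := f) (yhat := yhat) (planTime_le w k t)) (K * pinv K))
  have htrack_le := (he.integral_sqNorm_mulVec_target_sub_pred (f := f) (yhat := yhat)
    (planTime_le w k t) (K * pinv K)).trans_le (Finset.sum_le_sum_of_subset_of_nonneg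
      (Finset.range_subset_range.2 (sub_planTime_le t)) fun j _ _ => he.trace_nonneg _)
  have hswitch := integrable_sqrt (integrable_sqNorm
    (he.memLp_target_sub_pred (f := f) (yhat := yhat) hplan))
  have hswitch_le := he.integral_sqrt_sqNorm_target_sub_pred_le (f := f) (yhat := yhat) hplan
    ((sub_planTime_le (t - 1)).trans (Nat.succ_le_succ (windowPos_le w k (t - 1))))
  have hexcess : Integrable (fun ω =>
      constB K β * √(sqNorm (target f yhat (fun s => e s ω) (t - 1) -
        pred f yhat (fun s => e s ω) (planTime w k (t - 1)) (t - 1))) + 3 * constB K β ^ 2) μ :=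
    (hswitch.const_mul _).add (integrable_const _)
  simp only [fhcExcess]
  split_ifs
  · rw [integral_add (htrack.const_mul _) hexcess,
      integral_add (hswitch.const_mul _) (integrable_const _), integral_const_mul,
      integral_const_mul, integral_const, probReal_univ, one_smul]
    gcongr
    exact constB_nonneg hβ
  · simp only [add_zero]
    rw [integral_const_mul]
    gcongr

/-
The windows of the `w + 1` algorithms that contain `t` start at the `w + 1` different times
`t - w, …, t`.
-/
lemma IsNoise.sum_integral_fhcExcess_le [IsProbabilityMeasure μ] (he : IsNoise μ R e)
    (hK : IsUnit (Kᵀ * K)) (hβ : 0 ≤ β) (w t : ℕ) (yhat : ℕ → Fin m → ℝ) :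
    ∑ k ∈ Finset.range (w + 1), ∫ ω, fhcExcess K β w k (pred f yhat fun s => e s ω)
      (target f yhat fun s => e s ω) t ∂μ ≤ ((w : ℝ) + 1) * constV K β R f w := by
  refine (Finset.sum_le_sum fun k _ => he.integral_fhcExcess_le hβ w k t yhat).trans_eq ?_
  rw [sum_windowPos w t fun d => 1 / 2 * ∑ j ∈ Finset.range (d + 1),
      (R * ((K * pinv K * f j)ᵀ * (K * pinv K * f j))).trace +
    if d = 0 then constB K β * fNorm R f w + 3 * constB K β ^ 2 else 0,
    Finset.sum_add_distrib, ← Finset.mul_sum, ← bigF_eq_sum_sum hK, Finset.sum_ite_eq',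
    if_pos (Finset.mem_range.2 w.succ_pos), constV]
  field_simp
  ring

lemma IsNoise.integrable_sum_fhcExcess [IsFiniteMeasure μ] (he : IsNoise μ R e) (w T : ℕ)
    (yhat : ℕ → Fin m → ℝ) :
    Integrable (fun ω => 1 / ((w : ℝ) + 1) * ∑ t ∈ Finset.Icc 1 T, ∑ k ∈ Finset.range (w + 1),
      fhcExcess K β w k (pred f yhat fun s => e s ω) (target f yhat fun s => e s ω) t) μ :=
  (integrable_finsetSum _ fun t _ => integrable_finsetSum _ fun k _ =>
    he.integrable_fhcExcess w k t yhat).const_mul _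

lemma IsNoise.integrable_algCost_afhc [IsFiniteMeasure μ] (he : IsNoise μ R e)
    (hK : IsUnit (Kᵀ * K)) (hβ : 0 ≤ β) (w T : ℕ) (yhat : ℕ → Fin m → ℝ) :
    Integrable (algCost K β f e (afhc K β f e w) T yhat) μ := by
  refine ((he.integrable_optCostAt (K := K) (f := f) hβ T yhat).add
    (he.integrable_sum_fhcExcess (K := K) (β := β) (f := f) w T yhat)).mono'
    (he.measurable_algCost fun t ht =>
      he.measurable_afhc hK hβ w ht yhat).aestronglyMeasurable (ae_of_all _ fun ω => ?_)
  rw [Real.norm_of_nonneg (algCost_nonneg hβ _ T yhat ω)]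
  exact cost_afhcAction_le_optCost_add hK hβ w _ _

lemma IsNoise.integral_algCost_afhc_sub_optCostAt_le [IsProbabilityMeasure μ]
    (he : IsNoise μ R e) (hK : IsUnit (Kᵀ * K)) (hβ : 0 ≤ β) (w T : ℕ) (yhat : ℕ → Fin m → ℝ) :
    ∫ ω, (algCost K β f e (afhc K β f e w) T yhat ω - optCostAt K β f e T yhat ω) ∂μ ≤
      constV K β R f w * T := by
  have hw : (0 : ℝ) < w + 1 := by positivity
  refine (integral_mono ((he.integrable_algCost_afhc hK hβ w T yhat).sub
    (he.integrable_optCostAt hβ T yhat)) (he.integrable_sum_fhcExcess (K := K) (β := β) w T yhat)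
    fun ω => sub_le_iff_le_add'.2 (cost_afhcAction_le_optCost_add hK hβ w _ _)).trans ?_
  rw [integral_const_mul, integral_finsetSum _ fun t _ => integrable_finsetSum _ fun k _ =>
    he.integrable_fhcExcess w k t yhat]
  simp_rw [fun t => integral_finsetSum (Finset.range (w + 1)) fun k _ =>
    he.integrable_fhcExcess (K := K) (β := β) (f := f) w k t yhat]
  have hsum := Finset.sum_le_card_nsmul (Finset.Icc 1 T) _ _ fun t _ =>
    he.sum_integral_fhcExcess_le (f := f) hK hβ w t yhat
  rw [Nat.card_Icc, Nat.add_sub_cancel, nsmul_eq_mul] at hsum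
  rw [one_div, inv_mul_le_iff₀ hw]
  linarith

lemma IsNoise.constantCompetitive_afhc_of_constV_mul_le [IsProbabilityMeasure μ]
    (he : IsNoise μ R e) (hK : IsUnit (Kᵀ * K)) (hβ : 0 ≤ β) {w : ℕ} {C : ℝ}
    (h : ∀ (T : ℕ) (yhat : ℕ → Fin m → ℝ),
      constV K β R f w * T ≤ C * ∫ ω, optCostAt K β f e T yhat ω ∂μ) :
    ConstantCompetitive μ K β f e (afhc K β f e w) := by
  refine ⟨1 + C, fun T yhat => ?_⟩
  have halg := he.integrable_algCost_afhc (f := f) hK hβ w T yhat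
  have hopt := he.integrable_optCostAt (K := K) (f := f) hβ T yhat
  have hdiff := he.integral_algCost_afhc_sub_optCostAt_le (f := f) hK hβ w T yhat
  rw [integral_sub halg hopt] at hdiff
  exact ⟨halg, hopt, by linarith [h T yhat]⟩

lemma IsNoise.constantCompetitive_afhc_of_linear_le [IsProbabilityMeasure μ]
    (he : IsNoise μ R e) (hK : IsUnit (Kᵀ * K)) (hβ : 0 ≤ β) (w : ℕ) {c C : ℝ} (hc : 0 < c)
    (h : ∀ (T : ℕ) (yhat : ℕ → Fin m → ℝ), c * T ≤ C * ∫ ω, optCostAt K β f e T yhat ω ∂μ) :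
    ConstantCompetitive μ K β f e (afhc K β f e w) :=
  he.constantCompetitive_afhc_of_constV_mul_le hK hβ (C := |constV K β R f w| / c * C)
    fun T yhat => calc
      constV K β R f w * T
        ≤ |constV K β R f w| * T := by gcongr; exact le_abs_self _
      _ = |constV K β R f w| / c * (c * T) := by field_simp
      _ ≤ |constV K β R f w| / c * (C * ∫ ω, optCostAt K β f e T yhat ω ∂μ) :=
        mul_le_mul_of_nonneg_left (h T yhat) (by positivity)
      _ = |constV K β R f w| / c * C * ∫ ω, optCostAt K β f e T yhat ω ∂μ := by ring

lemma IsNoise.integral_optCostAt_sub_staCostAt_le [IsProbabilityMeasure μ] (he : IsNoise μ R e)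
    (hK : IsUnit (Kᵀ * K)) (hβ : 0 ≤ β) (T : ℕ) (yhat : ℕ → Fin m → ℝ) :
    ∫ ω, (optCostAt K β f e T yhat ω - staCostAt K β f e T yhat ω) ∂μ ≤
      4 * constB K β ^ 2 * T - 1 / 4 * expSpread μ K f e T yhat := by
  have hspread := (he.integrable_spread (K := K) (f := f) T yhat).const_mul (1 / 4)
  have hdiff := (he.integrable_optCostAt (K := K) (f := f) hβ T yhat).sub
    (he.integrable_staCostAt (K := K) (f := f) hβ T yhat)
  refine (integral_mono hdiff ((integrable_const (4 * constB K β ^ 2 * T)).sub hspread) fun ω =>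
      sub_le_iff_le_add'.2 (optCost_le_staCost_add hK hβ _)).trans_eq ?_
  rw [integral_sub' (integrable_const _) hspread, integral_const, probReal_univ, one_smul,
    integral_const_mul, expSpread]

lemma IsNoise.sublinearRegret_afhc [IsProbabilityMeasure μ] (he : IsNoise μ R e)
    (hK : IsUnit (Kᵀ * K)) (hβ : 0 ≤ β) (w : ℕ) {g : ℕ → ℝ}
    (hg : g =o[atTop] (fun T : ℕ => (T : ℝ)))
    (h : ∀ (T : ℕ) (yhat : ℕ → Fin m → ℝ),
      (4 * constV K β R f w + 16 * constB K β ^ 2) * T - g T ≤ expSpread μ K f e T yhat) :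
    SublinearRegret μ K β f e (afhc K β f e w) := by
  refine ⟨fun T => 1 / 4 * g T, hg.const_mul_left _, fun T yhat => ?_⟩
  have halg := he.integrable_algCost_afhc (f := f) hK hβ w T yhat
  have hopt := he.integrable_optCostAt (K := K) (f := f) hβ T yhat
  have hsta := he.integrable_staCostAt (K := K) (f := f) hβ T yhat
  have hdiff := he.integral_algCost_afhc_sub_optCostAt_le (f := f) hK hβ w T yhat
  have hstatic := he.integral_optCostAt_sub_staCostAt_le (f := f) hK hβ T yhat
  rw [integral_sub halg hopt] at hdiff
  rw [integral_sub hopt hsta] at hstatic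
  refine ⟨halg, hsta, ?_⟩
  rw [integral_sub halg hsta]
  linarith [h T yhat]

end Difference

/-! ### Linear growth of the expected dynamic optimum -/

section Growth

variable {K : Matrix (Fin m) (Fin n) ℝ} {β : ℝ} {f : ℕ → Matrix (Fin m) (Fin m) ℝ}
  {e : ℕ → Ω → Fin m → ℝ} {t : ℕ}

lemma optCostAt_update_zero (T : ℕ) (yhat : ℕ → Fin m → ℝ) :
    optCostAt K β f e T (Function.update yhat 0 0) = optCostAt K β f e T yhat := by
  ext1 ω
  refine iInf_congr fun x => costOn_congr (fun t ht => ?_) fun _ _ _ => rfl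
  rw [target, target, Function.update_of_ne (Nat.one_le_iff_ne_zero.1 (Finset.mem_Icc.1 ht).1)]

lemma target_sub_target_pred (hf : f 0 = 1) (yhat v : ℕ → Fin m → ℝ) (ht : 1 ≤ t) :
    target f yhat v t - target f yhat v (t - 1) = v t + (yhat t - yhat (t - 1) +
      ∑ s ∈ Finset.Ico 1 t, (f (t - s) - f (t - 1 - s)) *ᵥ v s) := by
  have hIcc : Finset.Icc 1 (t - 1) = Finset.Ico 1 t := by
    ext s; simp only [Finset.mem_Icc, Finset.mem_Ico]; omega
  rw [target_eq_add_sum_Ico hf v ht, target, hIcc]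
  simp only [Matrix.sub_mulVec, Finset.sum_sub_distrib]
  abel

variable [MeasurableSpace Ω] {μ : Measure Ω} {R : Matrix (Fin m) (Fin m) ℝ}

lemma IsNoise.integral_dotProduct_target_sub_target_pred [IsProbabilityMeasure μ]
    (he : IsNoise μ R e) (hf : f 0 = 1) (yhat : ℕ → Fin m → ℝ) (ht : 1 ≤ t)
    {φ : (Fin m → ℝ) → Fin m → ℝ} (hφ : Measurable φ)
    (hL2 : MemLp (fun ω => φ (e t ω)) 2 μ) (hmean : ∀ i, ∫ ω, φ (e t ω) i ∂μ = 0) :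
    ∫ ω, φ (e t ω) ⬝ᵥ
      (target f yhat (fun s => e s ω) t - target f yhat (fun s => e s ω) (t - 1)) ∂μ =
        ∫ ω, φ (e t ω) ⬝ᵥ e t ω ∂μ := by
  set v : Ω → Fin m → ℝ := fun ω => yhat t - yhat (t - 1) +
    ∑ s ∈ Finset.Ico 1 t, (f (t - s) - f (t - 1 - s)) *ᵥ e s ω
  have hvm : Measurable[past ⊥ e t] v := measurable_const.add
    (Finset.measurable_sum _ fun s hs => (measurable_mulVec _).comp (measurable_past hs))
  have hvL2 : MemLp v 2 μ := (memLp_const (yhat t - yhat (t - 1))).add (he.memLp_sum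
    (fun s hs => (Finset.mem_Ico.1 hs).1) fun s => f (t - s) - f (t - 1 - s))
  have hindep : IndepFun v (e t) μ := (IndepFun_iff_Indep _ _ _).2
    (indep_of_indep_of_le_left (he.indep_past bot_le (indep_bot_left _) ht) hvm.comap_le)
  have hzero : ∫ ω, φ (e t ω) ⬝ᵥ v ω ∂μ = 0 := by
    simp only [dotProduct_comm (φ _)]
    exact integral_dotProduct_eq_zero_of_indepFun (hvL2.integrable one_le_two)
      (hL2.integrable one_le_two) (hindep.comp measurable_id hφ) hmean
  simp only [target_sub_target_pred hf yhat _ ht, dotProduct_add (φ _) (e t _) (_ + _)]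
  rw [integral_add (integrable_dotProduct hL2 (he.memLp t ht)) (integrable_dotProduct hL2 hvL2),
    hzero, add_zero]

/-- The contribution of time `t` to the dual lower bound `sum_dotProduct_sub_le_cost` on the cost,
when the dual variable of time `t` is the function `φ` of the noise at time `t`. -/
def dualTerm (f : ℕ → Matrix (Fin m) (Fin m) ℝ) (φ : (Fin m → ℝ) → Fin m → ℝ)
    (yhat v : ℕ → Fin m → ℝ) (t : ℕ) : ℝ :=
  φ (v t) ⬝ᵥ (target f yhat v t - target f yhat v (t - 1)) - 2 * sqNorm (φ (v t))

lemma IsNoise.memLp_comp (he : IsNoise μ R e) (ht : 1 ≤ t) {φ : (Fin m → ℝ) → Fin d → ℝ}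
    (hφ : Measurable φ) (hL2 : MemLp (fun ω => φ (e 1 ω)) 2 μ) :
    MemLp (fun ω => φ (e t ω)) 2 μ :=
  ((he.ident t ht).comp hφ).symm.memLp_snd hL2

lemma IsNoise.integral_comp (he : IsNoise μ R e) (ht : 1 ≤ t) {g : (Fin m → ℝ) → ℝ}
    (hg : Measurable g) : ∫ ω, g (e t ω) ∂μ = ∫ ω, g (e 1 ω) ∂μ :=
  ((he.ident t ht).comp hg).integral_eq

lemma IsNoise.integrable_dualTerm [IsProbabilityMeasure μ] (he : IsNoise μ R e) (ht : 1 ≤ t)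
    {φ : (Fin m → ℝ) → Fin m → ℝ} (hφ : Measurable φ) (hL2 : MemLp (fun ω => φ (e 1 ω)) 2 μ)
    (yhat : ℕ → Fin m → ℝ) :
    Integrable (fun ω => dualTerm f φ yhat (fun s => e s ω) t) μ :=
  (integrable_dotProduct (he.memLp_comp ht hφ hL2)
    ((he.memLp_target f yhat t).sub (he.memLp_target f yhat (t - 1)))).sub
      ((integrable_sqNorm (he.memLp_comp ht hφ hL2)).const_mul 2)

lemma IsNoise.integral_dualTerm [IsProbabilityMeasure μ] (he : IsNoise μ R e) (hf : f 0 = 1)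
    (ht : 1 ≤ t) {φ : (Fin m → ℝ) → Fin m → ℝ} (hφ : Measurable φ)
    (hL2 : MemLp (fun ω => φ (e 1 ω)) 2 μ) (hmean : ∀ i, ∫ ω, φ (e 1 ω) i ∂μ = 0)
    (yhat : ℕ → Fin m → ℝ) :
    ∫ ω, dualTerm f φ yhat (fun s => e s ω) t ∂μ =
      ∫ ω, φ (e 1 ω) ⬝ᵥ e 1 ω ∂μ - 2 * ∫ ω, sqNorm (φ (e 1 ω)) ∂μ := by
  have hL2t := he.memLp_comp ht hφ hL2
  have hmeant : ∀ i, ∫ ω, φ (e t ω) i ∂μ = 0 := fun i =>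
    (he.integral_comp ht ((measurable_pi_apply i).comp hφ)).trans (hmean i)
  have hincr : Integrable (fun ω => φ (e t ω) ⬝ᵥ (target f yhat (fun s => e s ω) t -
      target f yhat (fun s => e s ω) (t - 1))) μ :=
    integrable_dotProduct hL2t ((he.memLp_target f yhat t).sub (he.memLp_target f yhat (t - 1)))
  have hdot : Measurable fun v => φ v ⬝ᵥ v := Finset.measurable_sum _ fun i _ =>
    ((measurable_pi_apply i).comp hφ).mul (measurable_pi_apply i)
  have hsq : Measurable fun v => sqNorm (φ v) := continuous_sqNorm.measurable.comp hφ
  simp only [dualTerm]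
  rw [integral_sub hincr ((integrable_sqNorm hL2t).const_mul 2), integral_const_mul,
    he.integral_dotProduct_target_sub_target_pred hf yhat ht hφ hL2t hmeant,
    he.integral_comp ht hdot, he.integral_comp ht hsq]

lemma IsNoise.mul_le_integral_optCostAt [IsProbabilityMeasure μ] (he : IsNoise μ R e)
    (hf : f 0 = 1) (hβ : 0 ≤ β) {φ : (Fin m → ℝ) → Fin m → ℝ} (hφ : Measurable φ)
    (hL2 : MemLp (fun ω => φ (e 1 ω)) 2 μ) (hmean : ∀ i, ∫ ω, φ (e 1 ω) i ∂μ = 0)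
    (hdual : ∀ v i, |(Kᵀ *ᵥ φ v) i| ≤ β) (T : ℕ) (yhat : ℕ → Fin m → ℝ) :
    T * (∫ ω, φ (e 1 ω) ⬝ᵥ e 1 ω ∂μ - 2 * ∫ ω, sqNorm (φ (e 1 ω)) ∂μ) ≤
      ∫ ω, optCostAt K β f e T yhat ω ∂μ := by
  set y₀ := Function.update yhat 0 0 with hy₀
  have hint : ∀ t ∈ Finset.Icc 1 T,
      Integrable (fun ω => dualTerm f φ y₀ (fun s => e s ω) t) μ := fun t ht =>
    he.integrable_dualTerm (Finset.mem_Icc.1 ht).1 hφ hL2 y₀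
  have hy₀_zero : ∀ v, target f y₀ v 0 = 0 := fun v => by simp [hy₀, target]
  calc T * (∫ ω, φ (e 1 ω) ⬝ᵥ e 1 ω ∂μ - 2 * ∫ ω, sqNorm (φ (e 1 ω)) ∂μ)
      = ∑ t ∈ Finset.Icc 1 T, ∫ ω, dualTerm f φ y₀ (fun s => e s ω) t ∂μ := by
        rw [Finset.sum_congr rfl fun t ht =>
          he.integral_dualTerm hf (Finset.mem_Icc.1 ht).1 hφ hL2 hmean y₀, Finset.sum_const,
          Nat.card_Icc, Nat.add_sub_cancel, nsmul_eq_mul]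
    _ = ∫ ω, ∑ t ∈ Finset.Icc 1 T, dualTerm f φ y₀ (fun s => e s ω) t ∂μ :=
        (integral_finsetSum _ hint).symm
    _ ≤ ∫ ω, optCostAt K β f e T y₀ ω ∂μ :=
        integral_mono (integrable_finsetSum _ hint) (he.integrable_optCostAt hβ T y₀) fun ω =>
          le_optCost fun x hx => sum_dotProduct_sub_le_cost (hy₀_zero _) (fun t => hdual (e t ω)) hx
    _ = ∫ ω, optCostAt K β f e T yhat ω ∂μ := by rw [hy₀, optCostAt_update_zero]

lemma measurable_sign : Measurable Real.sign :=
  Measurable.ite measurableSet_Iio measurable_const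
    (Measurable.ite measurableSet_Ioi measurable_const measurable_const)

lemma abs_sign_le_one (r : ℝ) : |Real.sign r| ≤ 1 := by
  rcases Real.sign_apply_eq r with h | h | h <;> simp [h]

lemma IsNoise.integral_abs_pos [IsProbabilityMeasure μ] (he : IsNoise μ R e) (i : Fin m) :
    0 < ∫ ω, |e 1 ω i| ∂μ := by
  refine (integral_nonneg fun ω => abs_nonneg _).lt_of_ne' fun h => ?_
  have hzero := (integral_eq_zero_iff_of_nonneg (fun ω => abs_nonneg (e 1 ω i))
    (((he.memLp 1 le_rfl).eval i).integrable one_le_two).abs).1 h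
  have hvar : ∫ ω, e 1 ω i * e 1 ω i ∂μ = 0 := integral_eq_zero_of_ae <| by
    filter_upwards [hzero] with ω hω
    simp only [abs_eq_zero.1 hω, mul_zero, Pi.zero_apply]
  exact he.posDef.diag_pos.ne' ((he.cov 1 le_rfl i i).symm.trans hvar)

/-- The centred sign of the `i`-th coordinate of the noise, as a vector in the direction of that
coordinate. It is a bounded function of the noise that is positively correlated with it. -/
def centredSign (μ : Measure Ω) (e : ℕ → Ω → Fin m → ℝ) (i : Fin m) (v : Fin m → ℝ) :
    Fin m → ℝ :=
  Pi.single i (Real.sign (v i) - ∫ ω, Real.sign (e 1 ω i) ∂μ)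

lemma measurable_centredSign (i : Fin m) : Measurable (centredSign μ e i) :=
  (continuous_single i).measurable.comp ((measurable_sign.comp (measurable_pi_apply i)).sub_const _)

lemma norm_centredSign_le [IsProbabilityMeasure μ] (i : Fin m) (v : Fin m → ℝ) :
    ‖centredSign μ e i v‖ ≤ 2 := by
  have hmean : |∫ ω, Real.sign (e 1 ω i) ∂μ| ≤ 1 := by
    simpa using norm_integral_le_of_norm_le_const (μ := μ) (f := fun ω => Real.sign (e 1 ω i))
      (ae_of_all _ fun ω => abs_sign_le_one (e 1 ω i))
  rw [centredSign, Pi.norm_single, Real.norm_eq_abs]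
  linarith [abs_sub (Real.sign (v i)) (∫ ω, Real.sign (e 1 ω i) ∂μ), abs_sign_le_one (v i)]

lemma sqNorm_centredSign_le [IsProbabilityMeasure μ] (i : Fin m) (v : Fin m → ℝ) :
    sqNorm (centredSign μ e i v) ≤ 4 := by
  have hnorm := norm_centredSign_le (μ := μ) (e := e) i v
  rw [centredSign, Pi.norm_single] at hnorm
  rw [sqNorm_eq_dotProduct, centredSign, single_dotProduct, Pi.single_eq_same, ← sq, ← sq_abs]
  exact (pow_le_pow_left₀ (abs_nonneg _) hnorm 2).trans_eq (by norm_num)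

lemma abs_transpose_mulVec_centredSign_le [IsProbabilityMeasure μ]
    (K : Matrix (Fin m) (Fin n) ℝ) (i : Fin m) (v : Fin m → ℝ) (j : Fin n) :
    |(Kᵀ *ᵥ centredSign μ e i v) j| ≤ 2 * ‖K i‖ := by
  have hnorm := norm_centredSign_le (μ := μ) (e := e) i v
  rw [centredSign, Pi.norm_single] at hnorm
  simp only [centredSign, Matrix.mulVec, dotProduct_single, Matrix.transpose_apply, abs_mul]
  rw [mul_comm]
  exact mul_le_mul hnorm (norm_le_pi_norm (K i) j) (abs_nonneg _) zero_le_two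

lemma IsNoise.memLp_centredSign [IsProbabilityMeasure μ] (he : IsNoise μ R e) (i : Fin m) :
    MemLp (fun ω => centredSign μ e i (e 1 ω)) 2 μ :=
  MemLp.of_bound ((measurable_centredSign i).comp (he.measurable 1 le_rfl)).aestronglyMeasurable 2
    (ae_of_all _ fun _ => norm_centredSign_le i _)

lemma IsNoise.integrable_sign [IsProbabilityMeasure μ] (he : IsNoise μ R e) (i : Fin m) :
    Integrable (fun ω => Real.sign (e 1 ω i)) μ :=
  Integrable.of_bound (measurable_sign.comp ((measurable_pi_apply i).comp
    (he.measurable 1 le_rfl))).aestronglyMeasurable 1 (ae_of_all _ fun _ => abs_sign_le_one _)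

lemma IsNoise.integral_centredSign_apply [IsProbabilityMeasure μ] (he : IsNoise μ R e)
    (i j : Fin m) :
    ∫ ω, centredSign μ e i (e 1 ω) j ∂μ = 0 := by
  simp only [centredSign]
  rcases eq_or_ne j i with rfl | hj
  · simp only [Pi.single_eq_same]
    rw [integral_sub (he.integrable_sign j) (integrable_const _), integral_const, probReal_univ,
      one_smul, sub_self]
  · simp only [Pi.single_eq_of_ne hj, integral_zero]

lemma IsNoise.integral_centredSign_dotProduct [IsProbabilityMeasure μ] (he : IsNoise μ R e)
    (i : Fin m) :
    ∫ ω, centredSign μ e i (e 1 ω) ⬝ᵥ e 1 ω ∂μ = ∫ ω, |e 1 ω i| ∂μ := by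
  have hint := ((he.memLp 1 le_rfl).eval i).integrable one_le_two
  have hsign : ∀ r : ℝ, Real.sign r * r = |r| := fun r => by
    rcases lt_trichotomy r 0 with h | rfl | h
    · rw [Real.sign_of_neg h, abs_of_neg h, neg_one_mul]
    · simp
    · rw [Real.sign_of_pos h, abs_of_pos h, one_mul]
  simp only [centredSign, single_dotProduct, sub_mul, hsign]
  rw [integral_sub hint.abs (hint.const_mul _), integral_const_mul, he.mean 1 le_rfl i, mul_zero,
    sub_zero]

lemma IsNoise.exists_linear_le_integral_optCostAt [IsProbabilityMeasure μ] (he : IsNoise μ R e)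
    (hf : f 0 = 1) (hβ : 0 < β) (i : Fin m) :
    ∃ c > 0, ∀ (T : ℕ) (yhat : ℕ → Fin m → ℝ), c * T ≤ ∫ ω, optCostAt K β f e T yhat ω ∂μ := by
  set q := ∫ ω, |e 1 ω i| ∂μ
  have hq_pos : 0 < q := he.integral_abs_pos i
  obtain ⟨δ, hδ, hδK, hδq⟩ : ∃ δ > 0, δ * (2 * ‖K i‖) ≤ β ∧ 16 * δ ≤ q := by
    refine ⟨min (β / (2 * (1 + ‖K i‖))) (q / 16), by positivity, ?_, ?_⟩
    · refine (mul_le_mul (min_le_left _ _) ?_ (by positivity) (by positivity)).trans_eq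
        (div_mul_cancel₀ β (b := 2 * (1 + ‖K i‖)) (by positivity))
      linarith
    · linarith [min_le_right (β / (2 * (1 + ‖K i‖))) (q / 16)]
  set φ : (Fin m → ℝ) → Fin m → ℝ := fun v => δ • centredSign μ e i v with hφ
  have hdot : ∫ ω, φ (e 1 ω) ⬝ᵥ e 1 ω ∂μ = δ * q := by
    simp only [hφ, smul_dotProduct, smul_eq_mul]
    rw [integral_const_mul, he.integral_centredSign_dotProduct]
  have hmean : ∀ j, ∫ ω, φ (e 1 ω) j ∂μ = 0 := fun j => by
    simp only [hφ, Pi.smul_apply, smul_eq_mul]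
    rw [integral_const_mul, he.integral_centredSign_apply, mul_zero]
  have hsq : ∫ ω, sqNorm (φ (e 1 ω)) ∂μ ≤ δ ^ 2 * 4 := by
    have hle := integral_mono (integrable_sqNorm (he.memLp_centredSign i)) (integrable_const 4)
      fun ω => sqNorm_centredSign_le i (e 1 ω)
    simp only [hφ, sqNorm_smul]
    rw [integral_const_mul]
    rw [integral_const, probReal_univ, one_smul] at hle
    gcongr
  have hdual : ∀ v j, |(Kᵀ *ᵥ φ v) j| ≤ β := fun v j => by
    rw [hφ, mulVec_smul, Pi.smul_apply, smul_eq_mul, abs_mul, abs_of_pos hδ]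
    exact (mul_le_mul_of_nonneg_left (abs_transpose_mulVec_centredSign_le K i v j) hδ.le).trans hδK
  refine ⟨δ * q / 2, by positivity, fun T yhat => ?_⟩
  refine le_trans ?_ (he.mul_le_integral_optCostAt hf hβ.le (φ := φ)
    ((measurable_centredSign i).const_smul δ) ((he.memLp_centredSign i).const_smul δ) hmean hdual
    T yhat)
  rw [mul_comm]
  gcongr
  rw [hdot]
  linarith [hsq, mul_le_mul_of_nonneg_left hδq hδ.le, sq δ]

end Growth

section ConstantCompetitive

variable [MeasurableSpace Ω] {μ : Measure Ω} [IsProbabilityMeasure μ]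
  {K : Matrix (Fin m) (Fin n) ℝ} {β : ℝ} {f : ℕ → Matrix (Fin m) (Fin m) ℝ}
  {R : Matrix (Fin m) (Fin m) ℝ} {e : ℕ → Ω → Fin m → ℝ}

lemma pinvNorm_of_isEmpty [IsEmpty (Fin m)] : pinvNorm K = 0 := by
  have hset : {r : ℝ | ∃ v : Fin m → ℝ, sqNorm v ≤ 1 ∧ r = l1Norm (pinv K *ᵥ v)} = {0} := by
    refine Set.eq_singleton_iff_unique_mem.2 ⟨⟨0, by simp [sqNorm], by simp⟩, ?_⟩
    rintro r ⟨v, -, rfl⟩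
    rw [Subsingleton.elim v 0, Matrix.mulVec_zero, l1Norm_zero]
  rw [pinvNorm, hset, csSup_singleton]

lemma IsNoise.constantCompetitive_afhc_of_isEmpty [IsEmpty (Fin m)] (he : IsNoise μ R e)
    (hK : IsUnit (Kᵀ * K)) (hβ : 0 ≤ β) (w : ℕ) :
    ConstantCompetitive μ K β f e (afhc K β f e w) := by
  refine he.constantCompetitive_afhc_of_constV_mul_le hK hβ (C := 0) fun T yhat => ?_
  simp [constV, constB, pinvNorm_of_isEmpty, bigF, Matrix.trace]

lemma IsNoise.constantCompetitive_afhc_of_online (he : IsNoise μ R e) (hK : IsUnit (Kᵀ * K))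
    (hf : f 0 = 1) (hβ : 0 ≤ β) {A : Alg m n Ω} (hA : IsOnline μ e A)
    (hcomp : ConstantCompetitive μ K β f e A) (w : ℕ) :
    ConstantCompetitive μ K β f e (afhc K β f e w) := by
  cases isEmpty_or_nonempty (Fin m)
  · exact he.constantCompetitive_afhc_of_isEmpty hK hβ w
  obtain ⟨C, hC⟩ := hcomp
  have htrace : 0 < R.trace :=
    Finset.sum_pos (fun _ _ => he.posDef.diag_pos) Finset.univ_nonempty
  refine he.constantCompetitive_afhc_of_linear_le hK hβ w (half_pos htrace) (C := C)
    fun T yhat => ?_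
  obtain ⟨hint, -, hle⟩ := hC T yhat
  have hlower := he.lintegral_algCost_ge (K := K) hf hβ hA T yhat
  rw [← ofReal_integral_eq_lintegral_ofReal hint (ae_of_all _ (algCost_nonneg hβ A T yhat)),
    ENNReal.ofReal_le_ofReal_iff (integral_nonneg (algCost_nonneg hβ A T yhat))] at hlower
  linarith

lemma IsNoise.constantCompetitive_afhc_of_pos (he : IsNoise μ R e) (hK : IsUnit (Kᵀ * K))
    (hf : f 0 = 1) (hβ : 0 < β) (w : ℕ) :
    ConstantCompetitive μ K β f e (afhc K β f e w) := by
  rcases isEmpty_or_nonempty (Fin m) with _ | ⟨⟨i⟩⟩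
  · exact he.constantCompetitive_afhc_of_isEmpty hK hβ.le w
  obtain ⟨c, hc, hle⟩ := he.exists_linear_le_integral_optCostAt (K := K) hf hβ i
  exact he.constantCompetitive_afhc_of_linear_le hK hβ.le w hc (C := 1) fun T yhat =>
    (hle T yhat).trans_eq (one_mul _).symm

end ConstantCompetitive

end OCOPred

end

theorem mainTheorem4 {m n : ℕ} {Ω : Type*} [MeasurableSpace Ω] (μ : Measure Ω)
    [IsProbabilityMeasure μ]
    (K : Matrix (Fin m) (Fin n) ℝ) (hK : IsUnit (K.transpose * K))
    (β : ℝ) (hβ : 0 ≤ β)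
    (R : Matrix (Fin m) (Fin m) ℝ)
    (f : ℕ → Matrix (Fin m) (Fin m) ℝ) (hf : f 0 = 1)
    (e : ℕ → Ω → Fin m → ℝ) (he : OCOPred.IsNoise μ R e) :
    -- every online algorithm has expected cost at least linear in the horizon
    (∀ A : OCOPred.Alg m n Ω, OCOPred.IsOnline μ e A → ∀ (T : ℕ) (yhat : ℕ → Fin m → ℝ),
      ENNReal.ofReal ((T : ℝ) / 2 * R.trace) ≤
        ∫⁻ ω, ENNReal.ofReal (OCOPred.algCost K β f e A T yhat ω) ∂μ) ∧
    ∀ w : ℕ,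
      -- expected competitive difference of AFHC
      (∀ (T : ℕ) (yhat : ℕ → Fin m → ℝ),
        Integrable (OCOPred.algCost K β f e (OCOPred.afhc K β f e w) T yhat) μ ∧
        Integrable (OCOPred.optCostAt K β f e T yhat) μ ∧
        ∫ ω, (OCOPred.algCost K β f e (OCOPred.afhc K β f e w) T yhat ω
          - OCOPred.optCostAt K β f e T yhat ω) ∂μ ≤ OCOPred.constV K β R f w * T) ∧
      -- constant competitive ratio, whenever some online algorithm has one
      ((∃ A : OCOPred.Alg m n Ω, OCOPred.IsOnline μ e A ∧
          OCOPred.ConstantCompetitive μ K β f e A) →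
        OCOPred.ConstantCompetitive μ K β f e (OCOPred.afhc K β f e w)) ∧
      -- which is always so if switching is not free
      (0 < β → OCOPred.ConstantCompetitive μ K β f e (OCOPred.afhc K β f e w)) ∧
      -- sublinear regret, whenever the targets are spread out enough
      ((∃ g : ℕ → ℝ, g =o[atTop] (fun T : ℕ => (T : ℝ)) ∧
          ∀ (T : ℕ) (yhat : ℕ → Fin m → ℝ),
            (4 * OCOPred.constV K β R f w + 16 * OCOPred.constB K β ^ 2) * T - g T ≤
              OCOPred.expSpread μ K f e T yhat) →
        OCOPred.SublinearRegret μ K β f e (OCOPred.afhc K β f e w)) := by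
  refine ⟨fun A hA T yhat => he.lintegral_algCost_ge hf hβ hA T yhat, fun w =>
    ⟨fun T yhat => ⟨he.integrable_algCost_afhc hK hβ w T yhat, he.integrable_optCostAt hβ T yhat,
      he.integral_algCost_afhc_sub_optCostAt_le hK hβ w T yhat⟩, ?_, ?_, ?_⟩⟩
  · rintro ⟨A, hA, hcomp⟩
    exact he.constantCompetitive_afhc_of_online hK hf hβ hA hcomp w
  · exact fun hβ' => he.constantCompetitive_afhc_of_pos hK hf hβ' w
  · rintro ⟨g, hg, h⟩
    exact he.sublinearRegret_afhc hK hβ w hg h
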